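/- All rings are commutative and Noetherian, and all modules are finitely generated. Let $(R,\mathfrak m)$ be a Cohen--Macaulay local ring with a canonical module $\omega$, that is, a maximal Cohen--Macaulay $R$-module of finite injective dimension such that the natural homomorphism $R\to\operatorname{Hom}_R(\omega,\omega)$ is an isomorphism. Then the following are equivalent: 1. $\omega$ has finite complete intersection dimension: there are local homomorphisms of local rings $R\to R'\leftarrow Q$ such that $R\to R'$ is flat, $Q\to R'$ is surjective with kernel generated by a $Q$-regular sequence (possibly empty) contained in the maximal ideal of $Q$, and $\omega\otimes_R R'$ has finite projective dimension over $Q$; 2. $\omega$ has finite $G$-dimension: there is an exact sequence $0\to G_n\to\cdots\to G_0\to\omega\to 0$ of finite length in which every $G_j$ has $G$-dimension zero, where a module $G$ has $G$-dimension zero if it is reflexive and $\operatorname{Ext}_R^i(G,R)=\operatorname{Ext}_R^i(G^*,R)=0$ for all $i>0$, with $(\ )^*=\operatorname{Hom}_R(\ ,R)$; 3. $R$ is Gorenstein, that is, $R$ has finite injective dimension as a module over itself. -/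

import Mathlib

open CategoryTheory TensorProduct

universe u

namespace CanonicalGrowth

noncomputable section

/-! ### Depth, Cohen--Macaulay rings, canonical modules -/

/-- The depth of a module over a local ring: the supremum of the lengths of the `M`-regular
sequences contained in the maximal ideal. -/
def depth (R : Type u) [CommRing R] [IsLocalRing R]
    (M : Type u) [AddCommGroup M] [Module R M] : ℕ∞ :=
  ⨆ (rs : List R) (_ : (∀ r ∈ rs, r ∈ IsLocalRing.maximalIdeal R) ∧
    RingTheory.Sequence.IsRegular M rs), (rs.length : ℕ∞)

/-- A (Noetherian) local ring is Cohen--Macaulay if its depth equals its Krull dimension. -/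
def IsCohenMacaulayLocalRing (R : Type u) [CommRing R] [IsLocalRing R] : Prop :=
  (depth R R : WithBot ℕ∞) = ringKrullDim R

/-- A maximal Cohen--Macaulay module over a (Noetherian) local ring: a nonzero finitely generated
module whose depth equals the Krull dimension of the ring. -/
structure IsMaximalCohenMacaulay (R : Type u) [CommRing R] [IsLocalRing R]
    (M : Type u) [AddCommGroup M] [Module R M] : Prop where
  finite : Module.Finite R M
  nontrivial : Nontrivial M
  depth_eq : (depth R M : WithBot ℕ∞) = ringKrullDim R

/-- The module `M` has finite injective dimension. -/
def HasFiniteInjectiveDimension (R : Type u) [CommRing R]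
    (M : Type u) [AddCommGroup M] [Module R M] : Prop :=
  ∃ n : ℕ, HasInjectiveDimensionLE (ModuleCat.of R M) n

/-- A canonical module: a maximal Cohen--Macaulay module of finite injective dimension such that
the natural homomorphism `R → Hom_R(ω, ω)`, sending `r` to multiplication by `r`, is an
isomorphism. -/
structure IsCanonicalModule (R : Type u) [CommRing R] [IsLocalRing R]
    (ω : Type u) [AddCommGroup ω] [Module R ω] : Prop where
  isMaximalCohenMacaulay : IsMaximalCohenMacaulay R ω
  finite_injectiveDimension : HasFiniteInjectiveDimension R ω
  bijective_homothety : Function.Bijective (algebraMap R (Module.End R ω))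

/-- A (Noetherian) local ring is Gorenstein if it has finite injective dimension as a module over
itself. -/
def IsGorensteinLocalRing (R : Type u) [CommRing R] : Prop :=
  HasFiniteInjectiveDimension R R

/-! ### Complete intersection dimension -/

/-- A homomorphism `g : Q → R` of local rings is a deformation of `R` if it is surjective and its
kernel is generated by a regular sequence contained in the maximal ideal of `Q`. -/
structure IsDeformation {Q R : Type u} [CommRing Q] [IsLocalRing Q] [CommRing R]
    (g : Q →+* R) : Prop where
  surjective : Function.Surjective g
  ker_eq : ∃ rs : List Q, (∀ r ∈ rs, r ∈ IsLocalRing.maximalIdeal Q) ∧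
    RingTheory.Sequence.IsRegular Q rs ∧ RingHom.ker g = Ideal.ofList rs

/-- A diagram `R → R' ← Q` of local homomorphisms, where the first map is the structure map of the
`R`-algebra `R'` and the second is `g`, is a quasi-deformation of `R` if `R → R'` is flat and `g`
is a deformation of `R'`. -/
structure IsQuasiDeformation (R : Type u) {R' Q : Type u} [CommRing R] [IsLocalRing R]
    [CommRing R'] [IsLocalRing R'] [Algebra R R'] [CommRing Q] [IsLocalRing Q]
    (g : Q →+* R') : Prop where
  isLocalHom : IsLocalHom (algebraMap R R')
  flat : Module.Flat R R'
  isDeformation : IsDeformation g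

/-- The `R`-module `M` has finite complete intersection dimension: there is a quasi-deformation
`R → R' ← Q`, all rings being Noetherian local, such that `R' ⊗_R M` has finite projective
dimension as a module over `Q`. -/
def HasFiniteCIDimension (R : Type u) [CommRing R] [IsLocalRing R]
    (M : Type u) [AddCommGroup M] [Module R M] : Prop :=
  ∃ (R' Q : Type u) (_ : CommRing R') (_ : IsLocalRing R') (_ : IsNoetherianRing R')
    (_ : Algebra R R') (_ : CommRing Q) (_ : IsLocalRing Q) (_ : IsNoetherianRing Q)
    (g : Q →+* R'), IsQuasiDeformation R g ∧
      ∃ n : ℕ, HasProjectiveDimensionLE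
        ((ModuleCat.restrictScalars g).obj (ModuleCat.of R' (R' ⊗[R] M))) n

/-! ### Gorenstein dimension -/

/-- A finitely generated module `M` has G-dimension zero if it is reflexive (the natural map
`M → M**` is an isomorphism) and `Ext^i(M, R) = Ext^i(M*, R) = 0` for all `i > 0`. -/
structure HasGDimensionZero (R : Type u) [CommRing R]
    (M : Type u) [AddCommGroup M] [Module R M] : Prop where
  finite : Module.Finite R M
  isReflexive : Module.IsReflexive R M
  ext_eq_zero : ∀ i : ℕ, 0 < i →
    Subsingleton (Abelian.Ext (ModuleCat.of R M) (ModuleCat.of R R) i)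
  ext_dual_eq_zero : ∀ i : ℕ, 0 < i →
    Subsingleton (Abelian.Ext (ModuleCat.of R (Module.Dual R M)) (ModuleCat.of R R) i)

/-- `M` has a resolution `0 → G_n → ⋯ → G_1 → G_0 → M → 0` by modules of G-dimension zero,
presented as an infinite exact sequence with `G_i = 0` for `i > n`. -/
def HasGResolution (R : Type u) [CommRing R]
    (M : Type u) [AddCommGroup M] [Module R M] (n : ℕ) : Prop :=
  ∃ (G : ℕ → ModuleCat.{u} R) (d : ∀ i, G (i + 1) →ₗ[R] G i) (ε : G 0 →ₗ[R] M),
    (∀ i, HasGDimensionZero R (G i)) ∧ (∀ i, n < i → Subsingleton (G i)) ∧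
    Function.Surjective ε ∧ Function.Exact (d 0) ε ∧ ∀ i, Function.Exact (d (i + 1)) (d i)

/-- The G-dimension of `M`: the minimal length of a resolution of `M` by modules of G-dimension
zero, and `⊤` if there is no such resolution of finite length. -/
def gDimension (R : Type u) [CommRing R]
    (M : Type u) [AddCommGroup M] [Module R M] : ℕ∞ :=
  ⨅ (n : ℕ) (_ : HasGResolution R M n), (n : ℕ∞)

end

end CanonicalGrowth

/-! The hub is projectivity of ω. A maximal Cohen--Macaulay module of finite projective dimension
over a Cohen--Macaulay local ring is projective (the equal-depth case of Auslander--Buchsbaum,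
`projective_of_pdLE`), so under either dimension hypothesis it is enough to show that ω has finite
projective dimension. If ω is projective, it is free and nonzero, so R is a direct summand of ω and
inherits finite injective dimension. Conversely, over a Gorenstein ring all high syzygies have
G-dimension zero.

Complete intersection dimension: finite injective dimension gives Ext^i(ω, ω) = 0 for large i, and
this survives flat base change. Let B = A/x with x regular, and let M be a B-module with finite
projective dimension over A. A presentation 0 → K → F → M → 0 over A reduces to 0 → M → B ⊗ K → B ⊗
F → M → 0, whose middle terms have finite projective dimension over B. Hence classes of high degree
in Ext_B(M, N) factor through Ext_B^{2j}(M, M) (`exists_comp_eq`), and vanishing self-extensions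
bound the projective dimension of M over B. Iteration over the regular sequence
(`change_of_rings_of_isWeaklyRegular`) and faithfully flat descent finish this case.

G-dimension: ω embeds in a module H of finite projective dimension with cokernel C of G-dimension
zero (`HasGResolution.exists_hull`). Since C has cosyzygies of every order and ω has finite
injective dimension, Ext^1(C, ω) = 0, so ω is a direct summand of H. -/

namespace CanonicalGrowth

open Abelian

/-! ### Vanishing of Ext along short exact sequences -/

section Ext

variable {R : Type u} [CommRing R]

/-- The group `Ext^i_R(M, N)` is zero. -/
abbrev ExtVanishes (R : Type u) [CommRing R] (M N : Type u) [AddCommGroup M] [Module R M]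
    [AddCommGroup N] [Module R N] (i : ℕ) : Prop :=
  Subsingleton (Ext (ModuleCat.of R M) (ModuleCat.of R N) i)

/-- A sequence of linear maps `0 → A → B → C → 0` is short exact. -/
structure IsSES {A B C : Type u} [AddCommGroup A] [Module R A] [AddCommGroup B] [Module R B]
    [AddCommGroup C] [Module R C] (f : A →ₗ[R] B) (g : B →ₗ[R] C) : Prop where
  injective : Function.Injective f
  exact : Function.Exact f g
  surjective : Function.Surjective g

variable {A B C M N P : Type u} [AddCommGroup A] [Module R A] [AddCommGroup B] [Module R B]
    [AddCommGroup C] [Module R C] [AddCommGroup M] [Module R M] [AddCommGroup N] [Module R N]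
    [AddCommGroup P] [Module R P]

/-- The short complex in the category of modules attached to a short exact sequence. -/
abbrev IsSES.shortComplex {f : A →ₗ[R] B} {g : B →ₗ[R] C} (h : IsSES f g) :
    ShortComplex (ModuleCat.{u} R) :=
  ShortComplex.mk (ModuleCat.ofHom f) (ModuleCat.ofHom g) (by
    ext x; exact h.exact.apply_apply_eq_zero x)

lemma IsSES.shortExact {f : A →ₗ[R] B} {g : B →ₗ[R] C} (h : IsSES f g) :
    h.shortComplex.ShortExact where
  exact := by
    rw [ShortComplex.ShortExact.moduleCat_exact_iff_function_exact]
    exact h.exact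
  mono_f := (ModuleCat.mono_iff_injective _).2 h.injective
  epi_g := (ModuleCat.epi_iff_surjective _).2 h.surjective

lemma isSES_ker_subtype (g : B →ₗ[R] C) (hg : Function.Surjective g) :
    IsSES (LinearMap.ker g).subtype g :=
  ⟨Submodule.subtype_injective _, LinearMap.exact_subtype_ker_map g, hg⟩

lemma isSES_range_mkQ (f : A →ₗ[R] B) (hf : Function.Injective f) :
    IsSES f (LinearMap.range f).mkQ :=
  ⟨hf, LinearMap.exact_map_mkQ_range f, Submodule.mkQ_surjective _⟩

section

variable {f : A →ₗ[R] B} {g : B →ₗ[R] C} (h : IsSES f g) {i : ℕ}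
include h

lemma IsSES.ext_left (hB : ExtVanishes R B N i) (hC : ExtVanishes R C N (i + 1)) :
    ExtVanishes R A N i := by
  refine subsingleton_of_forall_eq 0 fun x ↦ ?_
  obtain ⟨y, hy⟩ := Ext.contravariant_sequence_exact₁ h.shortExact (ModuleCat.of R N) x
    (add_comm 1 i) (hC.elim _ _)
  rw [← hy, hB.elim y 0, Ext.comp_zero]

lemma IsSES.ext_middle (hA : ExtVanishes R A N i) (hC : ExtVanishes R C N i) :
    ExtVanishes R B N i := by
  refine subsingleton_of_forall_eq 0 fun x ↦ ?_
  obtain ⟨y, hy⟩ := Ext.contravariant_sequence_exact₂ h.shortExact (ModuleCat.of R N) x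
    (hA.elim _ _)
  rw [← hy, hC.elim y 0, Ext.comp_zero]

lemma IsSES.ext_right (hA : ExtVanishes R A N i) (hB : ExtVanishes R B N (i + 1)) :
    ExtVanishes R C N (i + 1) := by
  refine subsingleton_of_forall_eq 0 fun x ↦ ?_
  obtain ⟨y, hy⟩ := Ext.contravariant_sequence_exact₃ h.shortExact (ModuleCat.of R N) x
    (hB.elim _ _) (add_comm 1 i)
  rw [← hy, hA.elim y 0, Ext.comp_zero]

lemma IsSES.exists_extend (hC : ExtVanishes R C N 1) (φ : A →ₗ[R] N) :
    ∃ ψ : B →ₗ[R] N, ψ ∘ₗ f = φ := by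
  obtain ⟨y, hy⟩ := Ext.contravariant_sequence_exact₁ h.shortExact (ModuleCat.of R N)
    (Ext.mk₀ (ModuleCat.ofHom φ)) (add_comm 1 0) (hC.elim _ _)
  obtain ⟨ψ, rfl⟩ := (Ext.mk₀_bijective _ _).2 y
  rw [Ext.mk₀_comp_mk₀, (Ext.mk₀_bijective _ _).1.eq_iff] at hy
  exact ⟨ψ.hom, by simpa using congrArg ModuleCat.Hom.hom hy⟩

/-- As Ext^1(B, N) = 0, every class is the class of the sequence pushed out along some φ : A → N; if
φ extends to B, that pushout splits. -/
lemma IsSES.ext_one_of_extend (hB : ExtVanishes R B N 1)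
    (hext : ∀ φ : A →ₗ[R] N, ∃ ψ : B →ₗ[R] N, ψ ∘ₗ f = φ) : ExtVanishes R C N 1 := by
  refine subsingleton_of_forall_eq 0 fun x ↦ ?_
  obtain ⟨y, hy⟩ := Ext.contravariant_sequence_exact₃ h.shortExact (ModuleCat.of R N) x
    (hB.elim _ _) (add_comm 1 0)
  obtain ⟨φ, rfl⟩ := (Ext.mk₀_bijective _ _).2 y
  obtain ⟨ψ, hψ⟩ := hext φ.hom
  have : φ = ModuleCat.ofHom f ≫ ModuleCat.ofHom ψ := by
    ext a; exact (LinearMap.congr_fun hψ a).symm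
  rw [← hy, this, ← Ext.mk₀_comp_mk₀, h.shortExact.extClass_comp_assoc]

lemma IsSES.exists_retraction (hC : ExtVanishes R C A 1) :
    ∃ ψ : B →ₗ[R] A, ψ ∘ₗ f = LinearMap.id :=
  h.exists_extend hC _

end

lemma extVanishes_of_retract_left (f : M →ₗ[R] P) (g : P →ₗ[R] M) (hgf : g ∘ₗ f = LinearMap.id)
    {i : ℕ} (h : ExtVanishes R P N i) : ExtVanishes R M N i := by
  refine subsingleton_of_forall_eq 0 fun x ↦ ?_
  have h1 : ModuleCat.ofHom f ≫ ModuleCat.ofHom g = 𝟙 (ModuleCat.of R M) := by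
    ext a; exact LinearMap.congr_fun hgf a
  rw [← Ext.mk₀_id_comp x, ← h1, ← Ext.mk₀_comp_mk₀_assoc,
    h.elim ((Ext.mk₀ (ModuleCat.ofHom g)).comp x (zero_add i)) 0, Ext.comp_zero]

lemma extVanishes_of_retract_right (f : M →ₗ[R] P) (g : P →ₗ[R] M) (hgf : g ∘ₗ f = LinearMap.id)
    {i : ℕ} (h : ExtVanishes R N P i) : ExtVanishes R N M i := by
  refine subsingleton_of_forall_eq 0 fun x ↦ ?_
  have h1 : ModuleCat.ofHom f ≫ ModuleCat.ofHom g = 𝟙 (ModuleCat.of R M) := by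
    ext a; exact LinearMap.congr_fun hgf a
  rw [← Ext.comp_mk₀_id x, ← h1, ← Ext.mk₀_comp_mk₀, ← Ext.comp_assoc_of_second_deg_zero,
    h.elim (x.comp (Ext.mk₀ (ModuleCat.ofHom f)) (add_zero i)) 0, Ext.zero_comp]

lemma extVanishes_of_projective [Module.Projective R P] {i : ℕ} (hi : 0 < i) :
    ExtVanishes R P N i := by
  obtain ⟨j, rfl⟩ := Nat.exists_eq_succ_of_ne_zero hi.ne'
  have : Projective (ModuleCat.of R P) := (IsProjective.iff_projective P).1 inferInstance
  exact Ext.subsingleton_of_projective _ _ j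

/-- Projective dimension at most `n`. -/
abbrev PdLE (R : Type u) [CommRing R] (M : Type u) [AddCommGroup M] [Module R M] (n : ℕ) : Prop :=
  HasProjectiveDimensionLE (ModuleCat.of R M) n

lemma PdLE.ext {n i : ℕ} (h : PdLE R M n) (hi : n < i) : ExtVanishes R M N i :=
  HasProjectiveDimensionLT.subsingleton _ (n + 1) i hi _

lemma pdLE_of_ext {n : ℕ} (h : ∀ (N : Type u) [AddCommGroup N] [Module R N] (i : ℕ), n < i →
    ExtVanishes R M N i) : PdLE R M n :=
  (hasProjectiveDimensionLT_iff _ _).2 fun i hi N e ↦ (h N i hi).elim e 0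

lemma pdLE_zero_iff : PdLE R M 0 ↔ Module.Projective R M :=
  (projective_iff_hasProjectiveDimensionLE_zero _).symm.trans (IsProjective.iff_projective M).symm

lemma PdLE.mono {n m : ℕ} (h : PdLE R M n) (hnm : n ≤ m) : PdLE R M m :=
  hasProjectiveDimensionLT_of_ge _ (n + 1) (m + 1) (by lia)

lemma IsSES.pdLE_succ_iff {f : A →ₗ[R] B} {g : B →ₗ[R] C} (h : IsSES f g)
    [Module.Projective R B] {n : ℕ} : PdLE R C (n + 1) ↔ PdLE R A n :=
  h.shortExact.hasProjectiveDimensionLT_X₃_iff n ((IsProjective.iff_projective B).1 inferInstance)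

lemma PdLE.of_retract (f : M →ₗ[R] P) (g : P →ₗ[R] M) (hgf : g ∘ₗ f = LinearMap.id)
    {n : ℕ} (h : PdLE R P n) : PdLE R M n :=
  pdLE_of_ext fun _ _ _ _ hi ↦ extVanishes_of_retract_left f g hgf (h.ext hi)

lemma IsSES.pdLE_right {f : A →ₗ[R] B} {g : B →ₗ[R] C} (h : IsSES f g) {n : ℕ}
    (hA : PdLE R A n) (hB : PdLE R B (n + 1)) : PdLE R C (n + 1) :=
  h.shortExact.hasProjectiveDimensionLT_X₃ (n + 1) hA hB

/-- Every module is a quotient of a free module. -/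
lemma exists_free_isSES (R : Type u) [CommRing R] (M : Type u) [AddCommGroup M] [Module R M] :
    ∃ (g : (M →₀ R) →ₗ[R] M), IsSES (A := LinearMap.ker g) (LinearMap.ker g).subtype g :=
  ⟨Finsupp.linearCombination R id, isSES_ker_subtype _ (Finsupp.linearCombination_id_surjective R M)⟩

/-- Every finitely generated module is a quotient of a finitely generated free module. -/
lemma exists_finite_free_isSES (R : Type u) [CommRing R] (M : Type u) [AddCommGroup M] [Module R M]
    [Module.Finite R M] :
    ∃ (n : ℕ) (g : (Fin n → R) →ₗ[R] M), IsSES (A := LinearMap.ker g) (LinearMap.ker g).subtype g := by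
  obtain ⟨n, g, hg⟩ := Module.Finite.exists_fin' R M
  exact ⟨n, g, isSES_ker_subtype g hg⟩

end Ext

/-! ### Change of rings by dimension shifting -/

section BaseChange

variable {A B : Type u} [CommRing A] [CommRing B] [Algebra A B]

lemma IsSES.baseChange_of_injective (B : Type u) [CommRing B] [Algebra A B]
    {K F G : Type u} [AddCommGroup K] [Module A K] [AddCommGroup F] [Module A F]
    [AddCommGroup G] [Module A G] {f : K →ₗ[A] F} {g : F →ₗ[A] G} (h : IsSES f g)
    (hf : Function.Injective (f.baseChange B)) : IsSES (f.baseChange B) (g.baseChange B) :=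
  ⟨hf, lTensor_exact B h.exact h.surjective, LinearMap.lTensor_surjective B h.surjective⟩

/-- A class of `A`-modules that is closed under first syzygies and whose free presentations remain
exact after tensoring with `B`. -/
structure PreservesPresentations (A B : Type u) [CommRing A] [CommRing B] [Algebra A B]
    (T : ∀ (G : Type u) [AddCommGroup G] [Module A G], Prop) : Prop where
  ker : ∀ (G : Type u) [AddCommGroup G] [Module A G] (g : (G →₀ A) →ₗ[A] G),
    T G → T (LinearMap.ker g)
  injective : ∀ (G : Type u) [AddCommGroup G] [Module A G] (g : (G →₀ A) →ₗ[A] G),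
    Function.Surjective g → T G → Function.Injective ((LinearMap.ker g).subtype.baseChange B)

namespace PreservesPresentations

variable {T : ∀ (G : Type u) [AddCommGroup G] [Module A G], Prop}
  (hT : PreservesPresentations A B T) {G : Type u} [AddCommGroup G] [Module A G]
include hT

lemma pdLE_baseChange {n : ℕ} (hG : T G) (hpd : PdLE A G n) : PdLE B (B ⊗[A] G) n := by
  induction n generalizing G with
  | zero =>
    rw [pdLE_zero_iff] at hpd ⊢
    infer_instance
  | succ n ih =>
    obtain ⟨g, hg⟩ := exists_free_isSES A G
    have h := hg.baseChange_of_injective B (hT.injective G g hg.surjective hG)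
    exact h.pdLE_succ_iff.2 (ih (hT.ker G g hG) (hg.pdLE_succ_iff.1 hpd))

/-- By the adjunction Hom_A(K, N) = Hom_B(B ⊗ K, N), extending maps from K to F is the same problem
over either ring; higher degrees follow by shifting. -/
lemma extVanishes_of_baseChange {N : Type u} [AddCommGroup N] [Module A N] [Module B N]
    [IsScalarTower A B N] {i : ℕ} (hG : T G) (h : ExtVanishes B (B ⊗[A] G) N (i + 1)) :
    ExtVanishes A G N (i + 1) := by
  induction i generalizing G with
  | zero =>
    obtain ⟨g, hg⟩ := exists_free_isSES A G
    refine hg.ext_one_of_extend (extVanishes_of_projective one_pos) fun φ ↦ ?_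
    obtain ⟨ψ, hψ⟩ := (hg.baseChange_of_injective B
      (hT.injective G g hg.surjective hG)).exists_extend h (φ.liftBaseChange B)
    refine ⟨ψ.restrictScalars A ∘ₗ TensorProduct.mk A B _ 1, ?_⟩
    ext k
    simpa using LinearMap.congr_fun hψ (1 ⊗ₜ k)
  | succ i ih =>
    obtain ⟨g, hg⟩ := exists_free_isSES A G
    refine hg.ext_right (ih (hT.ker G g hG) ?_) (extVanishes_of_projective (by lia))
    exact (hg.baseChange_of_injective B (hT.injective G g hg.surjective hG)).ext_left
      (extVanishes_of_projective (by lia)) h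

end PreservesPresentations

lemma preservesPresentations_of_flat (A B : Type u) [CommRing A] [CommRing B] [Algebra A B]
    [Module.Flat A B] : PreservesPresentations A B fun _ _ _ ↦ True :=
  ⟨fun _ _ _ _ _ ↦ trivial, fun _ _ _ _ _ _ ↦
    Module.Flat.lTensor_preserves_injective_linearMap _ (Submodule.subtype_injective _)⟩

/-! ### Reduction modulo a regular element -/

section Regular

variable (hs : Function.Surjective (algebraMap A B)) {x : A}
  (hk : RingHom.ker (algebraMap A B) = Ideal.span {x}) (hx : IsSMulRegular A x)

include hs in
lemma exists_one_tmul (G : Type u) [AddCommGroup G] [Module A G] (t : B ⊗[A] G) :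
    ∃ g : G, (1 : B) ⊗ₜ[A] g = t :=
  TensorProduct.mk_surjective A G B hs t

include hs hk in
lemma one_tmul_eq_zero_iff {G : Type u} [AddCommGroup G] [Module A G] (g : G) :
    (1 : B) ⊗ₜ[A] g = 0 ↔ ∃ g' : G, x • g' = g := by
  constructor
  · intro h
    have he : Function.Exact (LinearMap.lsmul A A x) (Algebra.linearMap A B) := by
      intro a
      change algebraMap A B a = 0 ↔ _
      rw [← RingHom.mem_ker, hk, Ideal.mem_span_singleton']
      simp only [Set.mem_range, LinearMap.lsmul_apply, smul_eq_mul, mul_comm x]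
    have h2 := (rTensor_exact G he hs ((1 : A) ⊗ₜ g)).1 (by simpa using h)
    obtain ⟨t, ht⟩ := h2
    obtain ⟨g', rfl⟩ := (TensorProduct.lid A G).symm.surjective t
    refine ⟨g', ?_⟩
    have := congrArg (TensorProduct.lid A G) ht
    simpa using this
  · rintro ⟨g', rfl⟩
    have : algebraMap A B x = 0 := by
      rw [← RingHom.mem_ker, hk]; exact Ideal.mem_span_singleton_self x
    rw [← TensorProduct.smul_tmul, Algebra.smul_def, this, zero_mul, TensorProduct.zero_tmul]

include hs hk in
-- The obstruction is Tor_1(A/x, G), the x-torsion of G, which is zero here.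
lemma IsSES.baseChange {K F G : Type u} [AddCommGroup K] [Module A K] [AddCommGroup F] [Module A F]
    [AddCommGroup G] [Module A G] {f : K →ₗ[A] F} {g : F →ₗ[A] G} (h : IsSES f g)
    (hG : IsSMulRegular G x) : IsSES (f.baseChange B) (g.baseChange B) := by
  refine h.baseChange_of_injective B ?_
  rw [injective_iff_map_eq_zero]
  intro t ht
  obtain ⟨k, rfl⟩ := exists_one_tmul hs K t
  rw [LinearMap.baseChange_tmul, one_tmul_eq_zero_iff hs hk] at ht
  obtain ⟨b, hb⟩ := ht
  have hgb : x • g b = x • (0 : G) := by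
    rw [← map_smul, hb, h.exact.apply_apply_eq_zero, smul_zero]
  obtain ⟨k', rfl⟩ := (h.exact b).1 (hG hgb)
  rw [← map_smul] at hb
  exact (one_tmul_eq_zero_iff hs hk k).2 ⟨k', h.injective hb⟩

include hx in
lemma isSMulRegular_finsupp (ι : Type u) : IsSMulRegular (ι →₀ A) x := by
  intro f g h
  ext i
  exact hx (by simpa using DFunLike.congr_fun h i)

lemma isSMulRegular_submodule {F : Type u} [AddCommGroup F] [Module A F] (hF : IsSMulRegular F x)
    (K : Submodule A F) : IsSMulRegular K x :=
  fun _ _ h ↦ Subtype.ext (hF (congrArg Subtype.val h))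

include hs hk hx in
lemma preservesPresentations_of_isSMulRegular :
    PreservesPresentations A B fun G _ _ ↦ IsSMulRegular G x :=
  ⟨fun G _ _ _ _ ↦ isSMulRegular_submodule (isSMulRegular_finsupp hx G) _,
    fun _ _ _ g hg hG ↦ ((isSES_ker_subtype g hg).baseChange hs hk hG).injective⟩

variable (M : Type u) [AddCommGroup M] [Module A M] [Module B M] [IsScalarTower A B M]

include hs hk in
/-- For a module `M` over `B = A / x`, reducing a presentation `0 → K → F → M → 0` over `A` modulo
`x` gives an exact sequence `0 → M → B ⊗ K → B ⊗ F → M → 0`. -/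
lemma exists_isSES_baseChange_ker {K F : Type u} [AddCommGroup K] [Module A K] [AddCommGroup F]
    [Module A F] {f : K →ₗ[A] F} {g : F →ₗ[A] M} (h : IsSES f g) (hF : IsSMulRegular F x) :
    ∃ (L : Submodule B (B ⊗[A] F)) (ι : M →ₗ[B] B ⊗[A] K)
      (β : B ⊗[A] K →ₗ[B] L) (p : (B ⊗[A] F) →ₗ[B] M),
      IsSES (C := L) ι β ∧ IsSES (A := L) L.subtype p := by
  have hx0 : ∀ m : M, x • m = 0 := fun m ↦ by
    have : algebraMap A B x = 0 := by
      rw [← RingHom.mem_ker, hk]; exact Ideal.mem_span_singleton_self x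
    rw [← algebraMap_smul B, this, zero_smul]
  -- The map ι is the snake map M = Tor_1(B, M) → B ⊗ K: lift m to b in F; then x • b lies in the
  -- image of K because x kills M.
  have hmem : ∀ m : M, ∃ k : K, ∃ b : F, g b = m ∧ f k = x • b := fun m ↦ by
    obtain ⟨b, rfl⟩ := h.surjective m
    obtain ⟨k, hk⟩ := (h.exact (x • b)).1 (by rw [map_smul, hx0])
    exact ⟨k, b, rfl, hk⟩
  choose κ lift hlift hκ using hmem
  -- Independence of the chosen lift, from which linearity of ι follows.
  have hι : ∀ (k : K) (b : F), f k = x • b → (1 : B) ⊗ₜ[A] k = 1 ⊗ₜ κ (g b) := by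
    intro k b hkb
    rw [← sub_eq_zero, ← TensorProduct.tmul_sub, one_tmul_eq_zero_iff hs hk]
    obtain ⟨k', hk'⟩ := (h.exact (b - lift (g b))).1 (by rw [map_sub, hlift, sub_self])
    refine ⟨k', h.injective ?_⟩
    rw [map_smul, hk', map_sub, hkb, hκ, smul_sub]
  let ι₀ : M →ₗ[A] B ⊗[A] K :=
    { toFun := fun m ↦ 1 ⊗ₜ κ m
      map_add' := fun m m' ↦ by
        rw [← TensorProduct.tmul_add, hι (κ m + κ m') (lift m + lift m')
          (by rw [map_add, hκ, hκ, smul_add]), map_add, hlift, hlift]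
      map_smul' := fun a m ↦ by
        rw [RingHom.id_apply, ← TensorProduct.tmul_smul, hι (a • κ m) (a • lift m)
          (by rw [map_smul, hκ, smul_comm]), map_smul, hlift] }
  have hι₀ : ∀ m, ι₀ m = 1 ⊗ₜ κ m := fun m ↦ rfl
  let p : (B ⊗[A] F) →ₗ[B] M := g.liftBaseChange B
  have hp : ∀ b, p (1 ⊗ₜ b) = g b := fun b ↦ by simp [p]
  let β : B ⊗[A] K →ₗ[B] LinearMap.ker p :=
    (f.baseChange B).codRestrict _ fun t ↦ by
      obtain ⟨k, rfl⟩ := exists_one_tmul hs _ t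
      rw [LinearMap.mem_ker, LinearMap.baseChange_tmul, hp, h.exact.apply_apply_eq_zero]
  have hβ : ∀ k, (β (1 ⊗ₜ k) : B ⊗[A] F) = 1 ⊗ₜ f k := fun k ↦ rfl
  refine ⟨LinearMap.ker p, ι₀.extendScalarsOfSurjective hs, β, p, ⟨?_, ?_, ?_⟩,
    isSES_ker_subtype p fun m ↦ ?_⟩
  · rw [injective_iff_map_eq_zero]
    intro m hm
    change ι₀ m = 0 at hm
    rw [hι₀, one_tmul_eq_zero_iff hs hk] at hm
    obtain ⟨k, hk'⟩ := hm
    have h1 : lift m = f k := hF (by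
      change x • lift m = x • f k
      rw [← hκ, ← hk', map_smul])
    rw [← hlift m, h1, h.exact.apply_apply_eq_zero]
  · intro t
    obtain ⟨k, rfl⟩ := exists_one_tmul hs _ t
    rw [← Submodule.coe_eq_zero, hβ, one_tmul_eq_zero_iff hs hk]
    constructor
    · rintro ⟨b, hb⟩
      exact ⟨g b, (hι k b hb.symm).symm⟩
    · rintro ⟨m, hm⟩
      have h2 : (1 : B) ⊗ₜ[A] f (κ m) = 1 ⊗ₜ f k :=
        congrArg (fun t ↦ (β t : B ⊗[A] F)) hm
      rw [← one_tmul_eq_zero_iff hs hk, ← h2, one_tmul_eq_zero_iff hs hk]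
      exact ⟨lift m, (hκ m).symm⟩
  · rintro ⟨t, ht⟩
    obtain ⟨b, rfl⟩ := exists_one_tmul hs _ t
    rw [LinearMap.mem_ker, hp] at ht
    obtain ⟨k, rfl⟩ := (h.exact b).1 ht
    exact ⟨1 ⊗ₜ k, Subtype.ext (hβ _)⟩
  · obtain ⟨b, rfl⟩ := h.surjective m
    exact ⟨1 ⊗ₜ b, hp b⟩

include hs hk hx in
-- Ext_A^{j+2}(M, N) is a shift of Ext_A^{j+1}(K, N), controlled by Ext_B^{j+1}(B ⊗ K, N). The
-- module B ⊗ K is an extension of L by M, and L is a syzygy of M over B.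
lemma eventually_extVanishes_restrictScalars (N : Type u) [AddCommGroup N] [Module A N] [Module B N]
    [IsScalarTower A B N] {n : ℕ} (h : ∀ i, n < i → ExtVanishes B M N i) :
    ∀ i, n + 1 < i → ExtVanishes A M N i := by
  intro i hi
  obtain ⟨j, rfl⟩ : ∃ j, i = j + 2 := ⟨i - 2, by lia⟩
  obtain ⟨g, hg⟩ := exists_free_isSES A M
  obtain ⟨L, ι, β, p, h1, h2⟩ := exists_isSES_baseChange_ker hs hk M hg (isSMulRegular_finsupp hx M)
  refine hg.ext_right ((preservesPresentations_of_isSMulRegular hs hk hx).extVanishes_of_baseChange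
    (isSMulRegular_submodule (isSMulRegular_finsupp hx M) _) ?_)
    (extVanishes_of_projective (by lia))
  exact h1.ext_middle (h _ (by lia))
    (h2.ext_left (extVanishes_of_projective (by lia)) (h _ (by lia)))

end Regular

end BaseChange

/-! ### Factoring extension classes through a periodic 2-extension -/

section Yoneda

variable {B : Type u} [CommRing B] {M G L F : Type u} [AddCommGroup M] [Module B M]
  [AddCommGroup G] [Module B G] [AddCommGroup L] [Module B L] [AddCommGroup F] [Module B F]

/-- If `0 → M → G → F → M → 0` is exact with `F` projective and `G` of finite projective dimension,
then every class in `Ext^i(M, N)` with `i` large is a multiple of a power of the class of this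
extension. -/
lemma exists_comp_eq {ι : M →ₗ[B] G} {β : G →ₗ[B] L} {s : L →ₗ[B] F} {p : F →ₗ[B] M}
    (h₁ : IsSES ι β) (h₂ : IsSES s p) [Module.Projective B F] {n : ℕ} (hG : PdLE B G n)
    (N : ModuleCat.{u} B) (j k : ℕ) (hk : n < k + 1) {i : ℕ} (hi : 2 * j + k = i)
    (y : Ext (ModuleCat.of B M) N i) :
    ∃ (c : Ext (ModuleCat.of B M) (ModuleCat.of B M) (2 * j)) (α : Ext (ModuleCat.of B M) N k),
      c.comp α hi = y := by
  induction j generalizing i with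
  | zero =>
    obtain rfl : k = i := by lia
    exact ⟨Ext.mk₀ (𝟙 _), y, Ext.mk₀_id_comp y⟩
  | succ j ih =>
    obtain ⟨l, rfl⟩ : ∃ l, i = l + 2 := ⟨i - 2, by lia⟩
    have : Projective (ModuleCat.of B F) := (IsProjective.iff_projective F).1 inferInstance
    -- Two connecting maps are surjective: the first since F is projective, the second since the
    -- degree l + 1 exceeds the projective dimension of G.
    obtain ⟨y₁, rfl⟩ := Ext.contravariant_sequence_exact₃ h₂.shortExact N y
      (Ext.eq_zero_of_projective _) (show 1 + (l + 1) = l + 2 by lia)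
    obtain ⟨y₂, rfl⟩ := Ext.contravariant_sequence_exact₃ h₁.shortExact N y₁
      ((hG.ext (N := N) (by lia)).elim _ _) (show 1 + l = l + 1 by lia)
    obtain ⟨c, α, rfl⟩ := ih (by lia) y₂
    refine ⟨h₂.shortExact.extClass.comp
      (h₁.shortExact.extClass.comp c (add_comm 1 (2 * j))) (by lia), α, ?_⟩
    rw [Ext.comp_assoc _ _ α _ (show 2 * j + 1 + k = l + 1 by lia) (by lia),
      Ext.comp_assoc _ _ α _ (show 2 * j + k = l by lia) (by lia)]

end Yoneda

/-! ### Projective dimension along a deformation -/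

section Deformation

open scoped Pointwise

lemma exists_pdLE_of_extVanishes_self {A B : Type u} [CommRing A] [CommRing B] [Algebra A B]
    (hs : Function.Surjective (algebraMap A B)) {x : A}
    (hk : RingHom.ker (algebraMap A B) = Ideal.span {x}) (hx : IsSMulRegular A x)
    (M : Type u) [AddCommGroup M] [Module A M] [Module B M] [IsScalarTower A B M] {n N : ℕ}
    (hpd : PdLE A M n) (h : ∀ i, N < i → ExtVanishes B M M i) : ∃ m, PdLE B M m := by
  obtain ⟨g, hg⟩ := exists_free_isSES A M
  obtain ⟨L, ι, β, p, h1, h2⟩ := exists_isSES_baseChange_ker hs hk M hg (isSMulRegular_finsupp hx M)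
  have hK : PdLE A (LinearMap.ker g) n := hg.pdLE_succ_iff.1 (hpd.mono n.le_succ)
  have hG := (preservesPresentations_of_isSMulRegular hs hk hx).pdLE_baseChange
    (isSMulRegular_submodule (isSMulRegular_finsupp hx M) _) hK
  -- The degree splits as 2(N+1) plus a remainder: 2(N+1) > N kills the self-extension factor, and
  -- the remainder exceeds n, as the factorization requires.
  refine ⟨n + 2 * (N + 1), pdLE_of_ext fun N' _ _ i hi ↦ subsingleton_of_forall_eq 0 fun y ↦ ?_⟩
  obtain ⟨c, α, rfl⟩ := exists_comp_eq h1 h2 hG (ModuleCat.of B N') (N + 1) (i - 2 * (N + 1))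
    (by lia) (by lia) y
  rw [(h (2 * (N + 1)) (by lia)).elim c 0, Ext.zero_comp]

/-- Change of rings along the quotient by a regular sequence: eventual vanishing of `Ext` passes
from the quotient to the ring, and if moreover `Ext(M, M)` eventually vanishes over the quotient
then finiteness of the projective dimension passes from the ring to the quotient. -/
theorem change_of_rings_of_isWeaklyRegular {A B : Type u} [CommRing A] [CommRing B] [Algebra A B]
    (hs : Function.Surjective (algebraMap A B)) (rs : List A)
    (hk : RingHom.ker (algebraMap A B) = Ideal.ofList rs)
    (hrs : RingTheory.Sequence.IsWeaklyRegular A rs)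
    (M : Type u) [AddCommGroup M] [Module A M] [Module B M] [IsScalarTower A B M] {N : ℕ}
    (h : ∀ i, N < i → ExtVanishes B M M i) :
    (∃ N', ∀ i, N' < i → ExtVanishes A M M i) ∧
      ∀ n, PdLE A M n → ∃ m, PdLE B M m := by
  obtain ⟨k, hk'⟩ : ∃ k, rs.length = k := ⟨_, rfl⟩
  induction k generalizing A with
  | zero =>
    obtain rfl := List.length_eq_zero_iff.1 hk'
    have hinj : Function.Injective (algebraMap A B) := by
      rw [injective_iff_map_eq_zero]
      intro a ha
      have : a ∈ Ideal.ofList ([] : List A) := hk ▸ ha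
      simpa using this
    have hflat : Module.Flat A B :=
      Module.Flat.of_linearEquiv (LinearEquiv.ofBijective (Algebra.linearMap A B) ⟨hinj, hs⟩).symm
    let f : M →ₗ[B] B ⊗[A] M := (TensorProduct.mk A B M 1).extendScalarsOfSurjective hs
    let g : B ⊗[A] M →ₗ[B] M := (LinearMap.id : M →ₗ[A] M).liftBaseChange B
    have hf : ∀ m, f m = 1 ⊗ₜ m := fun m ↦ rfl
    have hg : ∀ m, g (1 ⊗ₜ m) = m := fun m ↦ by simp [g]
    have hgf : g ∘ₗ f = LinearMap.id := by
      ext m; exact hg m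
    have hfg : f ∘ₗ g = LinearMap.id := by
      refine LinearMap.ext fun t ↦ ?_
      obtain ⟨m, rfl⟩ := exists_one_tmul hs M t
      simp [hf, hg]
    have hT := preservesPresentations_of_flat A B
    refine ⟨⟨N, fun i hi ↦ ?_⟩, fun n hn ↦ ⟨n, (hT.pdLE_baseChange trivial hn).of_retract f g hgf⟩⟩
    obtain ⟨j, rfl⟩ := Nat.exists_eq_add_of_lt hi
    exact hT.extVanishes_of_baseChange trivial (extVanishes_of_retract_left g f hfg (h _ hi))
  | succ k ih =>
    obtain ⟨r, rs, rfl⟩ := List.exists_cons_of_length_eq_add_one hk'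
    let A₁ := A ⧸ Ideal.span {r}
    rw [RingTheory.Sequence.isWeaklyRegular_cons_iff'] at hrs
    have hle : Ideal.span {r} ≤ RingHom.ker (algebraMap A B) := by
      rw [hk, Ideal.ofList_cons]; exact le_sup_left
    let φ : A₁ →+* B := Ideal.Quotient.lift _ (algebraMap A B) fun a ha ↦ hle ha
    let : Algebra A₁ B := φ.toAlgebra
    let : Module A₁ M := Module.compHom M φ
    have : IsScalarTower A₁ B M := ⟨fun a b m ↦ mul_smul (φ a) b m⟩
    have : IsScalarTower A A₁ M := ⟨fun a b m ↦ by
      obtain ⟨b, rfl⟩ := Ideal.Quotient.mk_surjective b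
      change algebraMap A B (a * b) • m = a • algebraMap A B b • m
      rw [map_mul, mul_smul, algebraMap_smul]⟩
    have hsφ : Function.Surjective (algebraMap A₁ B) := fun b ↦ by
      obtain ⟨a, rfl⟩ := hs b
      exact ⟨Ideal.Quotient.mk _ a, rfl⟩
    have hkφ : RingHom.ker (algebraMap A₁ B) =
        Ideal.ofList (rs.map (Ideal.Quotient.mk (Ideal.span {r}))) := by
      change RingHom.ker φ = _
      rw [Ideal.ker_quotient_lift, hk, ← Ideal.map_ofList, Ideal.ofList_cons, Ideal.map_sup,
        Ideal.map_quotient_self, bot_sup_eq]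
    have hA₁ : RingTheory.Sequence.IsWeaklyRegular A₁
        (rs.map (Ideal.Quotient.mk (Ideal.span {r}))) := by
      have hSM : r • (⊤ : Submodule A A) = Ideal.span {r} := by
        ext a
        simp [Submodule.mem_smul_pointwise_iff_exists, Ideal.mem_span_singleton', mul_comm]
      let e : QuotSMulTop r A ≃ₗ[A] A₁ := Submodule.quotEquivOfEq _ _ hSM
      exact ((e.extendScalarsOfSurjective
        (Ideal.Quotient.mk_surjective (I := Ideal.span {r}))).isWeaklyRegular_congr _).1 hrs.2
    -- The Ext-vanishing half of the induction, from B up to A₁, is what allows the descent of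
    -- projective dimension from A to A₁; its other half then carries it from A₁ to B.
    obtain ⟨⟨N', hN'⟩, hpd⟩ := ih hsφ _ hkφ hA₁ (by simpa using hk')
    have hsA : Function.Surjective (algebraMap A A₁) := Ideal.Quotient.mk_surjective
    have hkA : RingHom.ker (algebraMap A A₁) = Ideal.span {r} := Ideal.mk_ker
    refine ⟨⟨N' + 1, eventually_extVanishes_restrictScalars hsA hkA hrs.1 M M hN'⟩, fun n hn ↦ ?_⟩
    obtain ⟨m, hm⟩ := exists_pdLE_of_extVanishes_self hsA hkA hrs.1 M hn hN'
    exact hpd m hm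

end Deformation

/-! ### Flat base change and faithfully flat descent -/

section FlatBaseChange

variable {R S : Type u} [CommRing R] [IsNoetherianRing R] [CommRing S] [Algebra R S]

lemma ExtVanishes.baseChange (S : Type u) [CommRing S] [Algebra R S] [Module.Flat R S]
    {M N : Type u} [AddCommGroup M] [Module R M] [Module.Finite R M]
    [AddCommGroup N] [Module R N] {i : ℕ} (h : ExtVanishes R M N (i + 1)) :
    ExtVanishes S (S ⊗[R] M) (S ⊗[R] N) (i + 1) := by
  induction i generalizing M with
  | zero =>
    obtain ⟨n, g, hg⟩ := exists_finite_free_isSES R M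
    have hg' := hg.baseChange_of_injective S
      (Module.Flat.lTensor_preserves_injective_linearMap _ hg.injective)
    refine hg'.ext_one_of_extend (extVanishes_of_projective one_pos) fun φ ↦ ?_
    have : Module.FinitePresentation R (LinearMap.ker g) :=
      Module.finitePresentation_of_finite R _
    -- The syzygy is finitely presented, so Hom_S(S ⊗ K, S ⊗ N) is S ⊗ Hom_R(K, N), and only maps
    -- defined over R need to be extended.
    refine (Module.FinitePresentation.isBaseChange_map R (LinearMap.ker g) N S).inductionOn φ
      (fun φ ↦ ∃ ψ : S ⊗[R] (Fin n → R) →ₗ[S] S ⊗[R] N,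
        ψ ∘ₗ (LinearMap.ker g).subtype.baseChange S = φ) ⟨0, LinearMap.zero_comp _⟩ ?_ ?_ ?_
    · intro φ
      obtain ⟨ψ, rfl⟩ := hg.exists_extend h φ
      exact ⟨ψ.baseChange S, by rw [← LinearMap.baseChange_comp]; rfl⟩
    · rintro s _ ⟨ψ, rfl⟩
      exact ⟨s • ψ, LinearMap.smul_comp _ _ _⟩
    · rintro _ _ ⟨ψ, rfl⟩ ⟨ψ', rfl⟩
      exact ⟨ψ + ψ', LinearMap.add_comp _ _ _⟩
  | succ i ih =>
    obtain ⟨n, g, hg⟩ := exists_finite_free_isSES R M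
    have hg' := hg.baseChange_of_injective S
      (Module.Flat.lTensor_preserves_injective_linearMap _ hg.injective)
    exact hg'.ext_right (ih (hg.ext_left (extVanishes_of_projective (by lia)) h))
      (extVanishes_of_projective (by lia))

lemma PdLE.of_baseChange (S : Type u) [CommRing S] [Algebra R S] [Module.FaithfullyFlat R S]
    {n : ℕ} {M : Type u} [AddCommGroup M] [Module R M] [Module.Finite R M]
    (h : PdLE S (S ⊗[R] M) n) : PdLE R M n := by
  induction n generalizing M with
  | zero =>
    rw [pdLE_zero_iff] at h ⊢
    have := Module.Flat.of_flat_tensorProduct R M S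
    have : Module.FinitePresentation R M := Module.finitePresentation_of_finite R _
    exact Module.Flat.projective_of_finitePresentation
  | succ n ih =>
    obtain ⟨k, g, hg⟩ := exists_finite_free_isSES R M
    have hg' := hg.baseChange_of_injective S
      (Module.Flat.lTensor_preserves_injective_linearMap _ hg.injective)
    exact hg.pdLE_succ_iff.2 (ih (hg'.pdLE_succ_iff.1 h))

end FlatBaseChange

/-! ### Auslander--Buchsbaum for equal depths, through Ext from the residue field -/

section AuslanderBuchsbaum

variable {R : Type u} [CommRing R]

lemma comp_mk₀_sum_eq_zero {X : ModuleCat.{u} R} {M N : Type u} [AddCommGroup M] [Module R M]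
    [AddCommGroup N] [Module R N] {i : ℕ} (x : Ext X (ModuleCat.of R M) i) {ι : Type*}
    (s : Finset ι) (φ : ι → M →ₗ[R] N)
    (h : ∀ j ∈ s, x.comp (Ext.mk₀ (ModuleCat.ofHom (φ j))) (add_zero i) = 0) :
    x.comp (Ext.mk₀ (ModuleCat.ofHom (∑ j ∈ s, φ j))) (add_zero i) = 0 := by
  refine Finset.sum_induction φ
    (fun ψ ↦ x.comp (Ext.mk₀ (ModuleCat.ofHom ψ)) (add_zero i) = 0) ?_ ?_ h
  · intro a b ha hb
    rw [ModuleCat.ofHom_add, Ext.mk₀_add, Ext.comp_add, ha, hb, add_zero]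
  · rw [ModuleCat.ofHom_zero, Ext.mk₀_zero, Ext.comp_zero]

lemma extVanishes_pi {X : Type u} [AddCommGroup X] [Module R X] {M : Type u} [AddCommGroup M]
    [Module R M] {i : ℕ} (h : ExtVanishes R X M i) (n : ℕ) : ExtVanishes R X (Fin n → M) i := by
  refine subsingleton_of_forall_eq 0 fun x ↦ ?_
  have hid : 𝟙 (ModuleCat.of R (Fin n → M)) = ModuleCat.ofHom
      (∑ j : Fin n, LinearMap.single R (fun _ ↦ M) j ∘ₗ LinearMap.proj j) := by
    ext v j
    simp [Finset.sum_apply, Pi.single_apply]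
  rw [← Ext.comp_mk₀_id x, hid]
  refine comp_mk₀_sum_eq_zero x _ _ fun j _ ↦ ?_
  rw [ModuleCat.ofHom_comp, ← Ext.mk₀_comp_mk₀, ← Ext.comp_assoc_of_second_deg_zero,
    h.elim (x.comp (Ext.mk₀ (ModuleCat.ofHom (LinearMap.proj j))) (add_zero i)) 0, Ext.zero_comp]

/-- A map `R → F` given by an element of `I F` induces zero on `Ext^i(R / I, -)`. -/
lemma comp_toSpanSingleton_eq_zero {I : Ideal R} {F : Type u} [AddCommGroup F] [Module R F]
    {i : ℕ} (x : Ext (ModuleCat.of R (R ⧸ I)) (ModuleCat.of R R) i) {v : F}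
    (hv : v ∈ I • (⊤ : Submodule R F)) :
    x.comp (Ext.mk₀ (ModuleCat.ofHom (LinearMap.toSpanSingleton R F v))) (add_zero i) = 0 := by
  refine Submodule.smul_induction_on hv (fun r hr w _ ↦ ?_) fun v w hv hw ↦ ?_
  · have hx : r • x = 0 := by
      have := Ext.postcomp_smul_id_eq_zero_of_mem_annihilator (M := ModuleCat.of R R)
        (N := ModuleCat.of R (R ⧸ I)) (r := r) (by simpa [Ideal.annihilator_quotient] using hr) i
      simpa [Ext.mk₀_smul] using ConcreteCategory.congr_hom this x
    have : ModuleCat.ofHom (LinearMap.toSpanSingleton R F (r • w)) =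
        r • ModuleCat.ofHom (LinearMap.toSpanSingleton R F w) := by
      ext; simp
    rw [this, Ext.mk₀_smul, Ext.comp_smul, ← Ext.smul_comp, hx, Ext.zero_comp]
  · have : ModuleCat.ofHom (LinearMap.toSpanSingleton R F (v + w)) =
        ModuleCat.ofHom (LinearMap.toSpanSingleton R F v) +
          ModuleCat.ofHom (LinearMap.toSpanSingleton R F w) := by
      ext; simp
    rw [this, Ext.mk₀_add, Ext.comp_add, hv, hw, add_zero]

/-- The covariant map `Ext^i(X, A) → Ext^i(X, B)` is injective if `Ext^(i-1)(X, C)` vanishes. -/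
lemma IsSES.eq_zero_of_comp_eq_zero {X A B C : Type u} [AddCommGroup X] [Module R X]
    [AddCommGroup A] [Module R A] [AddCommGroup B] [Module R B] [AddCommGroup C] [Module R C]
    {f : A →ₗ[R] B} {g : B →ₗ[R] C} (h : IsSES f g) {i : ℕ}
    (hC : ∀ j < i, ExtVanishes R X C j) (x : Ext (ModuleCat.of R X) (ModuleCat.of R A) i)
    (hx : x.comp (Ext.mk₀ (ModuleCat.ofHom f)) (add_zero i) = 0) : x = 0 := by
  cases i with
  | zero =>
    have : Mono (ModuleCat.ofHom f) := h.shortExact.mono_f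
    refine Ext.postcomp_mk₀_injective_of_mono (ModuleCat.of R X) (ModuleCat.ofHom f) ?_
    rw [map_zero]
    exact hx
  | succ i =>
    obtain ⟨y, hy⟩ := Ext.covariant_sequence_exact₁ (ModuleCat.of R X) h.shortExact x hx rfl
    rw [← hy, (hC i i.lt_succ_self).elim y 0, Ext.zero_comp]

variable [IsLocalRing R]

local notation "𝔪" => IsLocalRing.maximalIdeal R

/-- Some coordinate of e in a basis is a unit. -/
lemma exists_retraction_toSpanSingleton {K : Type u} [AddCommGroup K] [Module R K]
    [Module.Free R K] {e : K} (he : e ∉ 𝔪 • (⊤ : Submodule R K)) :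
    ∃ ρ : K →ₗ[R] R, ρ e = 1 := by
  let b := Module.Free.chooseBasis R K
  by_contra! hρ
  apply he
  rw [← b.linearCombination_repr e, Finsupp.linearCombination_apply]
  refine Submodule.sum_mem _ fun i _ ↦ Submodule.smul_mem_smul ?_ trivial
  rw [IsLocalRing.mem_maximalIdeal, mem_nonunits_iff]
  intro hu
  obtain ⟨u, hu⟩ := hu
  refine hρ ((↑u⁻¹ : R) • b.coord i) ?_
  rw [LinearMap.smul_apply, Module.Basis.coord_apply, ← hu, smul_eq_mul, Units.inv_mul]

lemma one_tmul_residueField_eq_zero_iff {M : Type u} [AddCommGroup M] [Module R M] (m : M) :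
    (1 : IsLocalRing.ResidueField R) ⊗ₜ[R] m = 0 ↔ m ∈ 𝔪 • (⊤ : Submodule R M) := by
  rw [← LinearMap.ker_tensorProductMk]
  rfl

variable [IsNoetherianRing R] {d : ℕ}

/-- The case of equal depths of the Auslander--Buchsbaum formula: a module of finite projective
dimension whose depth is at least that of the ring is projective. -/
theorem projective_of_pdLE (hR : ∀ i < d, ExtVanishes R (R ⧸ 𝔪) R i)
    (hd : ¬ ExtVanishes R (R ⧸ 𝔪) R d) {n : ℕ} {M : Type u} [AddCommGroup M] [Module R M]
    [Module.Finite R M] (hM : ∀ i < d, ExtVanishes R (R ⧸ 𝔪) M i) (hpd : PdLE R M n) :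
    Module.Projective R M := by
  induction n generalizing M with
  | zero => exact pdLE_zero_iff.1 hpd
  | succ n ih =>
    obtain ⟨k, g, hg⟩ := exists_finite_free_isSES R M
    have hF : ∀ i < d, ExtVanishes R (R ⧸ 𝔪) (Fin k → R) i := fun i hi ↦ extVanishes_pi (hR i hi) k
    have hK : ∀ i < d, ExtVanishes R (R ⧸ 𝔪) (LinearMap.ker g) i := fun i hi ↦
      subsingleton_of_forall_eq 0 fun x ↦
        hg.eq_zero_of_comp_eq_zero (fun j hj ↦ hM j (hj.trans hi)) x ((hF i hi).elim _ _)
    have hKp := ih hK (hg.pdLE_succ_iff.1 hpd)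
    have hKf : Module.Free R (LinearMap.ker g) := Module.free_of_flat_of_isLocalRing
    have hsplit : ∃ l, l ∘ₗ (LinearMap.ker g).subtype = LinearMap.id := by
      rw [IsLocalRing.split_injective_iff_lTensor_residueField_injective, injective_iff_map_eq_zero]
      intro t ht
      obtain ⟨e, rfl⟩ := TensorProduct.mk_surjective R (LinearMap.ker g)
        (IsLocalRing.ResidueField R) IsLocalRing.residue_surjective t
      have he : (e : Fin k → R) ∈ 𝔪 • (⊤ : Submodule R (Fin k → R)) := by
        rw [← one_tmul_residueField_eq_zero_iff]
        exact ht
      refine (one_tmul_residueField_eq_zero_iff e).2 ?_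
      by_contra hn
      obtain ⟨ρ, hρ⟩ := exists_retraction_toSpanSingleton hn
      -- A minimal generator e of K lying in 𝔪F would kill Ext^d(k, R), with k the residue field:
      -- the map to Ext^d(k, F) given by e is zero, Ext^d(k, K) → Ext^d(k, F) is injective, and ρ
      -- retracts R → K.
      refine hd (subsingleton_of_forall_eq 0 fun x ↦ ?_)
      have h1 : x.comp (Ext.mk₀ (ModuleCat.ofHom
          (LinearMap.toSpanSingleton R (LinearMap.ker g) e))) (add_zero d) = 0 := by
        apply hg.eq_zero_of_comp_eq_zero hM
        rw [Ext.comp_assoc_of_second_deg_zero, Ext.mk₀_comp_mk₀]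
        exact comp_toSpanSingleton_eq_zero x he
      have h2 : ModuleCat.ofHom (LinearMap.toSpanSingleton R (LinearMap.ker g) e) ≫
          ModuleCat.ofHom ρ = 𝟙 (ModuleCat.of R R) := by
        ext; simpa using hρ
      rw [← Ext.comp_mk₀_id x, ← h2, ← Ext.mk₀_comp_mk₀, ← Ext.comp_assoc_of_second_deg_zero, h1,
        Ext.zero_comp]
    obtain ⟨l, hl⟩ := hsplit
    refine pdLE_zero_iff.1 (pdLE_of_ext fun N _ _ i hi ↦ ?_)
    obtain ⟨j, rfl⟩ := Nat.exists_eq_succ_of_ne_zero hi.ne'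
    cases j with
    | zero =>
      refine hg.ext_one_of_extend (extVanishes_of_projective one_pos) fun φ ↦ ⟨φ ∘ₗ l, ?_⟩
      rw [LinearMap.comp_assoc, hl, LinearMap.comp_id]
    | succ j =>
      exact hg.ext_right (extVanishes_of_projective j.succ_pos)
        (extVanishes_of_projective (j + 1).succ_pos)

end AuslanderBuchsbaum

/-! ### Depth measured by Ext, and maximal Cohen--Macaulay modules -/

section Depth

variable {R : Type u} [CommRing R] [IsLocalRing R]

local notation "𝔪" => IsLocalRing.maximalIdeal R

lemma smul_top_lt_top (M : Type u) [AddCommGroup M] [Module R M] [Module.Finite R M]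
    [Nontrivial M] : 𝔪 • (⊤ : Submodule R M) < ⊤ :=
  (Submodule.top_ne_ideal_smul_of_le_jacobson_annihilator
    (IsLocalRing.maximalIdeal_le_jacobson _)).symm.lt_top

variable [IsNoetherianRing R]

lemma extVanishes_of_lt_depth {M : Type u} [AddCommGroup M] [Module R M] [Module.Finite R M]
    [Nontrivial M] {i : ℕ} (hi : (i : ℕ∞) < depth R M) : ExtVanishes R (R ⧸ 𝔪) M i := by
  simp only [depth, lt_iSup_iff, Nat.cast_lt] at hi
  obtain ⟨rs, ⟨hmem, hreg⟩, hlt⟩ := hi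
  exact ModuleCat.subsingleton_ext_of_exists_isRegular 𝔪 (ModuleCat.of R (R ⧸ 𝔪))
    (by rw [Module.support_eq_zeroLocus, Ideal.annihilator_quotient]) (ModuleCat.of R M)
    (smul_top_lt_top M) rs hmem hreg i hlt

/-- Otherwise Rees' theorem would produce a regular sequence of length d + 1. -/
lemma not_extVanishes_of_depth_eq {M : Type u} [AddCommGroup M] [Module R M] [Module.Finite R M]
    [Nontrivial M] {d : ℕ} (hd : depth R M = d) : ¬ ExtVanishes R (R ⧸ 𝔪) M d := by
  intro h
  obtain ⟨rs, hlen, hmem, hreg⟩ := ModuleCat.exists_isRegular_of_exists_subsingleton_ext 𝔪 (d + 1)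
    (ModuleCat.of R M) (smul_top_lt_top M) (ModuleCat.of R (R ⧸ 𝔪))
    (by rw [Module.support_eq_zeroLocus, Ideal.annihilator_quotient]) fun i hi ↦ by
      rcases Nat.lt_succ_iff_lt_or_eq.1 hi with hi | rfl
      · exact extVanishes_of_lt_depth (by rw [hd]; exact_mod_cast hi)
      · exact h
  have : (rs.length : ℕ∞) ≤ depth R M := by
    rw [depth]
    exact le_iSup₂_of_le rs ⟨hmem, hreg⟩ le_rfl
  rw [hd, hlen] at this
  norm_cast at this
  lia

/-- Over a Cohen--Macaulay local ring, a maximal Cohen--Macaulay module of finite projective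
dimension is projective. -/
theorem IsMaximalCohenMacaulay.projective_of_pdLE (hR : IsCohenMacaulayLocalRing R) {M : Type u}
    [AddCommGroup M] [Module R M] (hM : IsMaximalCohenMacaulay R M) {n : ℕ} (hpd : PdLE R M n) :
    Module.Projective R M := by
  have := hM.finite
  have := hM.nontrivial
  have heq : depth R M = depth R R := by
    have := hM.depth_eq.trans hR.symm
    exact_mod_cast this
  have hfin : depth R R ≠ ⊤ := fun h ↦ by
    have h2 : ringKrullDim R < ⊤ := ringKrullDim_lt_top
    rw [← hR, h] at h2
    exact lt_irrefl _ h2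
  obtain ⟨d, hd⟩ := ENat.ne_top_iff_exists.1 hfin
  refine CanonicalGrowth.projective_of_pdLE (d := d) (fun i hi ↦ extVanishes_of_lt_depth ?_)
    (not_extVanishes_of_depth_eq hd.symm) (fun i hi ↦ extVanishes_of_lt_depth ?_) hpd
  · rw [← hd]; exact_mod_cast hi
  · rw [heq, ← hd]; exact_mod_cast hi

end Depth

/-! ### Finite complete intersection dimension -/

section CIDimension

/-- Finite projective dimension passes from the source of a deformation to its target, for modules
whose higher self-extensions eventually vanish. -/
lemma IsDeformation.exists_pdLE {Q S : Type u} [CommRing Q] [IsLocalRing Q] [CommRing S]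
    {g : Q →+* S} (hg : IsDeformation g) (M : Type u) [AddCommGroup M] [Module S M] {N n : ℕ}
    (h : ∀ i, N < i → ExtVanishes S M M i)
    (hpd : HasProjectiveDimensionLE ((ModuleCat.restrictScalars g).obj (ModuleCat.of S M)) n) :
    ∃ m, PdLE S M m := by
  obtain ⟨rs, -, hrs, hker⟩ := hg.ker_eq
  let : Algebra Q S := g.toAlgebra
  let : Module Q M := Module.compHom M g
  have : IsScalarTower Q S M := ⟨fun a b m ↦ mul_smul (g a) b m⟩
  exact (change_of_rings_of_isWeaklyRegular (A := Q) (B := S) hg.surjective rs hker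
    hrs.toIsWeaklyRegular M h).2 n hpd

variable {R : Type u} [CommRing R] [IsLocalRing R]

/-- A finitely generated module of finite complete intersection dimension all of whose higher
self-extensions vanish has finite projective dimension. -/
theorem HasFiniteCIDimension.exists_pdLE [IsNoetherianRing R] {M : Type u} [AddCommGroup M]
    [Module R M] [Module.Finite R M] (h : HasFiniteCIDimension R M) {N : ℕ}
    (hM : ∀ i, N < i → ExtVanishes R M M i) : ∃ n, PdLE R M n := by
  obtain ⟨S, Q, _, _, _, _, _, _, _, g, hg, n, hn⟩ := h
  have := hg.isLocalHom
  have := hg.flat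
  have : Module.FaithfullyFlat R S := Module.FaithfullyFlat.of_flat_of_isLocalHom
  obtain ⟨m, hm⟩ := hg.isDeformation.exists_pdLE (S ⊗[R] M) (N := N) (fun i hi ↦ by
    obtain ⟨j, rfl⟩ := Nat.exists_eq_add_of_lt hi
    exact (hM _ hi).baseChange S) hn
  exact ⟨m, hm.of_baseChange S⟩

/-- The identity maps R → R ← R, with the empty regular sequence, form a quasi-deformation. -/
lemma hasFiniteCIDimension_of_projective [IsNoetherianRing R] {M : Type u} [AddCommGroup M]
    [Module R M] [Module.Projective R M] : HasFiniteCIDimension R M := by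
  refine ⟨R, R, inferInstance, inferInstance, inferInstance, inferInstance, inferInstance,
    inferInstance, inferInstance, RingHom.id R,
    ⟨⟨fun _ h ↦ h⟩, inferInstance, Function.surjective_id, [], by simp, ?_, ?_⟩, 0, ?_⟩
  · exact ⟨RingTheory.Sequence.IsWeaklyRegular.nil R R, by simp⟩
  · simp [RingHom.ker_eq_bot_iff_eq_zero]
  · exact pdLE_zero_iff.2 (inferInstanceAs (Module.Projective R (R ⊗[R] M)))

end CIDimension

/-! ### From projectivity to the Gorenstein property -/

section Gorenstein

variable {R : Type u} [CommRing R]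

lemma HasFiniteInjectiveDimension.exists_extVanishes {M : Type u} [AddCommGroup M] [Module R M]
    (h : HasFiniteInjectiveDimension R M) :
    ∃ n, ∀ (N : Type u) [AddCommGroup N] [Module R N] (i : ℕ), n < i → ExtVanishes R N M i := by
  obtain ⟨n, hn⟩ := h
  exact ⟨n, fun N _ _ i hi ↦ HasInjectiveDimensionLT.subsingleton _ (n + 1) i hi _⟩

/-- M is free and nonzero, so R is a retract of it. -/
lemma isGorensteinLocalRing_of_projective [IsLocalRing R] {M : Type u} [AddCommGroup M] [Module R M]
    [Module.Finite R M] [Nontrivial M] [Module.Projective R M]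
    (h : HasFiniteInjectiveDimension R M) : IsGorensteinLocalRing R := by
  obtain ⟨n, hn⟩ := h.exists_extVanishes
  have : Module.Free R M := Module.free_of_flat_of_isLocalRing
  let b := Module.Free.chooseBasis R M
  obtain ⟨i⟩ := b.index_nonempty
  refine ⟨n, (hasInjectiveDimensionLT_iff _ _).2 fun j hj N x ↦ ?_⟩
  exact (extVanishes_of_retract_right (LinearMap.toSpanSingleton R M (b i)) (b.coord i)
    (by ext; simp) (hn N j hj)).elim x 0

end Gorenstein

/-! ### Biduality and short exact sequences -/

section Duality

variable {R : Type u} [CommRing R] {A B C : Type u} [AddCommGroup A] [Module R A]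
  [AddCommGroup B] [Module R B] [AddCommGroup C] [Module R C]
  {f : A →ₗ[R] B} {g : B →ₗ[R] C} (h : IsSES f g)

lemma eval_eq_dualMap_dualMap (f : A →ₗ[R] B) (a : A) :
    f.dualMap.dualMap (Module.Dual.eval R A a) = Module.Dual.eval R B (f a) := rfl

include h

lemma IsSES.exact_dualMap : Function.Exact g.dualMap f.dualMap :=
  LinearMap.exact_lcomp_of_exact_of_surjective R h.exact h.surjective

lemma IsSES.dualMap (hC : ExtVanishes R C R 1) : IsSES g.dualMap f.dualMap :=
  ⟨LinearMap.dualMap_injective_of_surjective h.surjective, h.exact_dualMap,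
    fun φ ↦ h.exists_extend hC φ⟩

lemma IsSES.eval_injective_left (hB : Function.Injective (Module.Dual.eval R B)) :
    Function.Injective (Module.Dual.eval R A) := by
  rw [injective_iff_map_eq_zero]
  intro a ha
  apply h.injective
  rw [map_zero]
  apply hB
  rw [map_zero, ← eval_eq_dualMap_dualMap, ha, map_zero]

lemma IsSES.eval_surjective_left (hC : ExtVanishes R C R 1)
    (hB : Function.Surjective (Module.Dual.eval R B))
    (hC' : Function.Injective (Module.Dual.eval R C)) :
    Function.Surjective (Module.Dual.eval R A) := by
  intro α
  obtain ⟨b, hb⟩ := hB (f.dualMap.dualMap α)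
  have hgb : g b = 0 := by
    apply hC'
    rw [map_zero, ← eval_eq_dualMap_dualMap, hb]
    ext φ
    exact (congrArg α ((h.exact_dualMap (g.dualMap φ)).2 ⟨φ, rfl⟩)).trans (map_zero α)
  obtain ⟨a, rfl⟩ := (h.exact b).1 hgb
  refine ⟨a, LinearMap.dualMap_injective_of_surjective (h.dualMap hC).surjective ?_⟩
  rw [eval_eq_dualMap_dualMap, hb]

lemma IsSES.isReflexive_left (hC : ExtVanishes R C R 1) [Module.IsReflexive R B]
    (hC' : Function.Injective (Module.Dual.eval R C)) : Module.IsReflexive R A :=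
  ⟨h.eval_injective_left (Module.bijective_dual_eval R B).1,
    h.eval_surjective_left hC (Module.bijective_dual_eval R B).2 hC'⟩

lemma IsSES.isReflexive_middle (hC : ExtVanishes R C R 1) [Module.IsReflexive R A]
    [Module.IsReflexive R C] : Module.IsReflexive R B := by
  have hA := Module.bijective_dual_eval R A
  have hC' := Module.bijective_dual_eval R C
  have hinj : Function.Injective f.dualMap.dualMap :=
    LinearMap.dualMap_injective_of_surjective (h.dualMap hC).surjective
  refine ⟨(injective_iff_map_eq_zero _).2 fun b hb ↦ ?_, fun β ↦ ?_⟩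
  · obtain ⟨a, rfl⟩ := (h.exact b).1 (hC'.1 (by
      rw [map_zero, ← eval_eq_dualMap_dualMap, hb, map_zero]))
    rw [← eval_eq_dualMap_dualMap, ← map_zero f.dualMap.dualMap] at hb
    rw [(injective_iff_map_eq_zero _).1 hA.1 a (hinj hb), map_zero]
  · obtain ⟨c, hc⟩ := hC'.2 (g.dualMap.dualMap β)
    obtain ⟨b, rfl⟩ := h.surjective c
    obtain ⟨α, hα⟩ := ((h.dualMap hC).exact_dualMap (β - Module.Dual.eval R B b)).1 (by
      rw [map_sub, eval_eq_dualMap_dualMap, hc, sub_self])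
    obtain ⟨a, rfl⟩ := hA.2 α
    refine ⟨f a + b, ?_⟩
    rw [map_add, ← eval_eq_dualMap_dualMap, hα, sub_add_cancel]

end Duality

/-! ### Modules of G-dimension zero -/

section GDimensionZero

variable {R : Type u} [CommRing R] {A B C : Type u} [AddCommGroup A] [Module R A]
  [AddCommGroup B] [Module R B] [AddCommGroup C] [Module R C]
  {f : A →ₗ[R] B} {g : B →ₗ[R] C}

lemma HasGDimensionZero.ext (hA : HasGDimensionZero R A) {i : ℕ} (hi : 0 < i) :
    ExtVanishes R A R i := hA.ext_eq_zero i hi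

lemma HasGDimensionZero.ext_dual (hA : HasGDimensionZero R A) {i : ℕ} (hi : 0 < i) :
    ExtVanishes R (Module.Dual R A) R i := hA.ext_dual_eq_zero i hi

lemma hasGDimensionZero_of_projective [Module.Finite R A] [Module.Projective R A] :
    HasGDimensionZero R A :=
  ⟨inferInstance, inferInstance, fun _ hi ↦ extVanishes_of_projective hi,
    fun _ hi ↦ extVanishes_of_projective hi⟩

variable [IsNoetherianRing R]

lemma HasGDimensionZero.dual (hA : HasGDimensionZero R A) :
    HasGDimensionZero R (Module.Dual R A) := by
  have := hA.finite
  have := hA.isReflexive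
  refine ⟨inferInstance, inferInstance, hA.ext_dual_eq_zero, fun i hi ↦ ?_⟩
  exact extVanishes_of_retract_left (Module.evalEquiv R A).symm.toLinearMap
    (Module.evalEquiv R A).toLinearMap (by ext; simp) (hA.ext hi)

lemma IsSES.hasGDimensionZero_middle (h : IsSES f g) (hA : HasGDimensionZero R A)
    (hC : HasGDimensionZero R C) : HasGDimensionZero R B := by
  have := hA.finite
  have := hC.finite
  have := hA.isReflexive
  have := hC.isReflexive
  have : IsNoetherian R B := isNoetherian_of_range_eq_ker f g h.exact.linearMap_ker_eq.symm
  exact ⟨inferInstance, h.isReflexive_middle (hC.ext one_pos),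
    fun i hi ↦ h.ext_middle (hA.ext hi) (hC.ext hi),
    fun i hi ↦ (h.dualMap (hC.ext one_pos)).ext_middle (hC.ext_dual hi) (hA.ext_dual hi)⟩

lemma IsSES.hasGDimensionZero_left (h : IsSES f g) [Module.Finite R B] [Module.Projective R B]
    (hC : HasGDimensionZero R C) : HasGDimensionZero R A := by
  have := hC.isReflexive
  refine ⟨Module.Finite.of_injective f h.injective,
    h.isReflexive_left (hC.ext one_pos) (Module.bijective_dual_eval R C).1,
    fun i hi ↦ h.ext_left (extVanishes_of_projective hi) (hC.ext i.succ_pos), fun i hi ↦ ?_⟩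
  have hd := h.dualMap (hC.ext one_pos)
  obtain ⟨j, rfl⟩ := Nat.exists_eq_succ_of_ne_zero hi.ne'
  cases j with
  | zero =>
    -- By reflexivity of C, a functional on C* is evaluation at some c; evaluation at a preimage of
    -- c in B extends it to B*.
    refine hd.ext_one_of_extend (extVanishes_of_projective one_pos) fun φ ↦ ?_
    obtain ⟨c, rfl⟩ := (Module.bijective_dual_eval R C).2 φ
    obtain ⟨b, rfl⟩ := h.surjective c
    exact ⟨Module.Dual.eval R B b, rfl⟩
  | succ j =>
    exact hd.ext_right (hC.ext_dual j.succ_pos) (extVanishes_of_projective (j + 1).succ_pos)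

/-- A module of G-dimension zero embeds in a finitely generated projective module with cokernel of
G-dimension zero. -/
lemma HasGDimensionZero.exists_cosyzygy (hA : HasGDimensionZero R A) :
    ∃ (P C : Type u) (_ : AddCommGroup P) (_ : Module R P) (_ : AddCommGroup C) (_ : Module R C)
      (f : A →ₗ[R] P) (g : P →ₗ[R] C), Module.Finite R P ∧ Module.Projective R P ∧
        HasGDimensionZero R C ∧ IsSES f g := by
  have := hA.isReflexive
  have := hA.dual.finite
  -- Dualizing a free cover of A* embeds A = A** in a free module.
  obtain ⟨n, p, hp⟩ := exists_finite_free_isSES R (Module.Dual R A)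
  have hd := hp.dualMap (hA.ext_dual one_pos)
  refine ⟨Module.Dual R (Fin n → R), Module.Dual R (LinearMap.ker p), inferInstance, inferInstance,
    inferInstance, inferInstance, p.dualMap ∘ₗ (Module.evalEquiv R A).toLinearMap,
    (LinearMap.ker p).subtype.dualMap, inferInstance, inferInstance,
    (hp.hasGDimensionZero_left hA.dual).dual, ?_, ?_, hd.surjective⟩
  · exact hd.injective.comp (Module.evalEquiv R A).injective
  · intro x
    rw [hd.exact x]
    exact ((Module.evalEquiv R A).surjective.range_comp p.dualMap ▸ Iff.rfl)

/-- Passing to cosyzygies raises the degree until it exceeds the injective dimension of N. -/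
lemma HasGDimensionZero.extVanishes (hA : HasGDimensionZero R A) {N : Type u} [AddCommGroup N]
    [Module R N] (hN : HasFiniteInjectiveDimension R N) {i : ℕ} (hi : 0 < i) :
    ExtVanishes R A N i := by
  obtain ⟨n, hn⟩ := hN.exists_extVanishes
  obtain ⟨m, hm⟩ : ∃ m, n < i + m := ⟨n + 1, by lia⟩
  induction m generalizing A i with
  | zero => exact hn A i hm
  | succ m ih =>
    obtain ⟨P, C, _, _, _, _, f, g, _, _, hC, h⟩ := hA.exists_cosyzygy
    exact h.ext_left (extVanishes_of_projective hi) (ih hC i.succ_pos (by lia))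

end GDimensionZero

/-! ### Pushouts and quotients of short exact sequences -/

section Pushout

variable {R : Type u} [CommRing R]

lemma exists_comp_eq_of_ker_le {P M N : Type u} [AddCommGroup P] [Module R P] [AddCommGroup M]
    [Module R M] [AddCommGroup N] [Module R N] {p : P →ₗ[R] M} (hp : Function.Surjective p)
    (φ : P →ₗ[R] N) (hφ : ∀ x, p x = 0 → φ x = 0) : ∃ ψ : M →ₗ[R] N, ψ ∘ₗ p = φ := by
  refine ⟨(LinearMap.ker p).liftQ φ hφ ∘ₗ (p.quotKerEquivOfSurjective hp).symm.toLinearMap, ?_⟩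
  ext x
  have : (p.quotKerEquivOfSurjective hp).symm (p x) = Submodule.Quotient.mk x := by
    rw [LinearEquiv.symm_apply_eq]; rfl
  exact congrArg ((LinearMap.ker p).liftQ φ hφ) this

variable {K G H C : Type u} [AddCommGroup K] [Module R K] [AddCommGroup G] [Module R G]
  [AddCommGroup H] [Module R H] [AddCommGroup C] [Module R C]

/-- In a pushout square of monomorphisms, opposite cokernels agree. -/
lemma IsSES.exists_isSES_pushout {P : Type u} [AddCommGroup P] [Module R P] {i : K →ₗ[R] G}
    {f : K →ₗ[R] H} {g : H →ₗ[R] C} (h : IsSES f g) {u : G →ₗ[R] P} {v : H →ₗ[R] P}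
    (hsurj : ∀ p, ∃ x y, u x + v y = p)
    (hker : ∀ x y, u x + v y = 0 ↔ ∃ k, i k = x ∧ f k = -y) :
    ∃ q : P →ₗ[R] C, IsSES u q := by
  obtain ⟨q, hq⟩ := exists_comp_eq_of_ker_le (p := u.coprod v) (fun p ↦ by
    obtain ⟨x, y, rfl⟩ := hsurj p
    exact ⟨(x, y), by simp⟩) (g ∘ₗ LinearMap.snd R G H) (by
      rintro ⟨x, y⟩ hxy
      obtain ⟨k, -, hk⟩ := (hker x y).1 (by simpa using hxy)
      have := h.exact.apply_apply_eq_zero k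
      rw [hk, map_neg, neg_eq_zero] at this
      exact this)
  have hq' : ∀ x y, q (u x + v y) = g y := fun x y ↦ by
    simpa using LinearMap.congr_fun hq (x, y)
  refine ⟨q, ?_, fun p ↦ ⟨fun hp ↦ ?_, ?_⟩, fun c ↦ ?_⟩
  · rw [injective_iff_map_eq_zero]
    intro x hx
    obtain ⟨k, rfl, hk⟩ := (hker x 0).1 (by rw [hx, map_zero, add_zero])
    rw [h.injective (a₁ := k) (a₂ := 0) (by rw [hk, neg_zero, map_zero]), map_zero]
  · obtain ⟨x, y, rfl⟩ := hsurj p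
    rw [hq'] at hp
    obtain ⟨k, rfl⟩ := (h.exact y).1 hp
    refine ⟨x + i k, ?_⟩
    have := (hker (i (-k)) (f k)).2 ⟨-k, rfl, by rw [map_neg]⟩
    rw [map_add, add_right_inj, ← sub_eq_zero, ← neg_eq_zero, ← this, map_neg, map_neg]
    abel
  · rintro ⟨x, rfl⟩
    simpa using hq' x 0
  · obtain ⟨y, rfl⟩ := h.surjective c
    exact ⟨u 0 + v y, hq' 0 y⟩

lemma IsSES.exists_pushout {M : Type u} [AddCommGroup M] [Module R M] {i : K →ₗ[R] G}
    {e : G →ₗ[R] M} (h₁ : IsSES i e) {f : K →ₗ[R] H} {g : H →ₗ[R] C} (h₂ : IsSES f g) :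
    ∃ (P : Type u) (_ : AddCommGroup P) (_ : Module R P) (u : G →ₗ[R] P) (q : P →ₗ[R] C)
      (v : H →ₗ[R] P) (p : P →ₗ[R] M), IsSES u q ∧ IsSES v p := by
  let D : Submodule R (G × H) := LinearMap.range (i.prod (-f))
  let u : G →ₗ[R] (G × H) ⧸ D := D.mkQ ∘ₗ LinearMap.inl R G H
  let v : H →ₗ[R] (G × H) ⧸ D := D.mkQ ∘ₗ LinearMap.inr R G H
  have huv : ∀ x y, u x + v y = D.mkQ (x, y) := fun x y ↦ by
    exact (map_add D.mkQ (x, 0) (0, y)).symm.trans (by rw [Prod.mk_add_mk, add_zero, zero_add])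
  have hsurj : ∀ p, ∃ x y, u x + v y = p := fun p ↦ by
    obtain ⟨⟨x, y⟩, rfl⟩ := D.mkQ_surjective p
    exact ⟨x, y, huv x y⟩
  have hker : ∀ x y, u x + v y = 0 ↔ ∃ k, i k = x ∧ f k = -y := fun x y ↦ by
    rw [huv, Submodule.mkQ_apply, Submodule.Quotient.mk_eq_zero, LinearMap.mem_range]
    simp [Prod.ext_iff, neg_eq_iff_eq_neg]
  obtain ⟨q, hq⟩ := h₂.exists_isSES_pushout hsurj hker
  -- The same statement with G and H exchanged; the sign in `hker` turns k into -k.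
  obtain ⟨p, hp⟩ := h₁.exists_isSES_pushout (i := f) (u := v) (v := u)
    (fun p ↦ by
      obtain ⟨x, y, h⟩ := hsurj p
      exact ⟨y, x, by rw [add_comm, h]⟩)
    (fun y x ↦ by
      rw [add_comm, hker]
      constructor
      · rintro ⟨k, hx, hy⟩
        exact ⟨-k, by rw [map_neg, hy, neg_neg], by rw [map_neg, hx]⟩
      · rintro ⟨k, hy, hx⟩
        exact ⟨-k, by rw [map_neg, hx, neg_neg], by rw [map_neg, hy]⟩)
  exact ⟨_, inferInstance, inferInstance, u, q, v, p, hq, hp⟩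

/-- If `H ⊆ P ⊆ F`, then `0 → P / H → F / H → F / P → 0` is exact. -/
lemma IsSES.exists_isSES_quotient {P F M : Type u} [AddCommGroup P] [Module R P] [AddCommGroup F]
    [Module R F] [AddCommGroup M] [Module R M] {v : H →ₗ[R] P} {p : P →ₗ[R] M} (h₁ : IsSES v p)
    {f : P →ₗ[R] F} {g : F →ₗ[R] C} (h₂ : IsSES f g) :
    ∃ (a : M →ₗ[R] F ⧸ LinearMap.range (f ∘ₗ v)) (b : F ⧸ LinearMap.range (f ∘ₗ v) →ₗ[R] C),
      IsSES a b := by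
  let D := LinearMap.range (f ∘ₗ v)
  obtain ⟨a, ha⟩ := exists_comp_eq_of_ker_le h₁.surjective (D.mkQ ∘ₗ f) fun x hx ↦ by
    obtain ⟨y, rfl⟩ := (h₁.exact x).1 hx
    exact (Submodule.Quotient.mk_eq_zero D).2 ⟨y, rfl⟩
  have ha' : ∀ x, a (p x) = D.mkQ (f x) := fun x ↦ LinearMap.congr_fun ha x
  have hg : D ≤ LinearMap.ker g := by
    rintro _ ⟨y, rfl⟩
    exact h₂.exact.apply_apply_eq_zero _
  refine ⟨a, D.liftQ g hg, ?_, ?_, ?_⟩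
  · rw [injective_iff_map_eq_zero]
    intro m hm
    obtain ⟨x, rfl⟩ := h₁.surjective m
    rw [ha', Submodule.mkQ_apply, Submodule.Quotient.mk_eq_zero] at hm
    obtain ⟨y, hy⟩ := hm
    rw [← h₂.injective hy, h₁.exact.apply_apply_eq_zero]
  · intro z
    obtain ⟨z, rfl⟩ := D.mkQ_surjective z
    change g z = 0 ↔ _
    constructor
    · intro hz
      obtain ⟨x, rfl⟩ := (h₂.exact z).1 hz
      exact ⟨p x, ha' x⟩
    · rintro ⟨m, hm⟩
      obtain ⟨x, rfl⟩ := h₁.surjective m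
      rw [ha', Submodule.mkQ_apply, Submodule.mkQ_apply, Submodule.Quotient.eq] at hm
      have := hg hm
      rw [LinearMap.mem_ker, map_sub, h₂.exact.apply_apply_eq_zero, zero_sub, neg_eq_zero] at this
      exact this
  · intro c
    obtain ⟨z, rfl⟩ := h₂.surjective c
    exact ⟨D.mkQ z, rfl⟩

end Pushout

/-! ### Finite G-dimension and hulls of finite projective dimension -/

section GResolution

variable {R : Type u} [CommRing R] {M : Type u} [AddCommGroup M] [Module R M]

lemma HasGDimensionZero.hasGResolution (hM : HasGDimensionZero R M) : HasGResolution R M 0 := by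
  refine ⟨fun i ↦ Nat.casesOn i (ModuleCat.of R M) fun _ ↦ ModuleCat.of R PUnit, fun _ ↦ 0,
    LinearMap.id, ?_, ?_, Function.surjective_id, ?_, ?_⟩
  · rintro (_ | i)
    · exact hM
    · exact hasGDimensionZero_of_projective (A := PUnit)
  · rintro (_ | i) hi
    · exact absurd hi (lt_irrefl 0)
    · exact inferInstanceAs (Subsingleton PUnit)
  · intro x
    exact ⟨fun hx ↦ ⟨PUnit.unit, hx.symm⟩, fun ⟨_, hx⟩ ↦ hx.symm⟩
  · intro i x
    exact ⟨fun _ ↦ ⟨PUnit.unit, rfl⟩, fun _ ↦ rfl⟩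

lemma HasGResolution.succ {K G : Type u} [AddCommGroup K] [Module R K] [AddCommGroup G]
    [Module R G] {f : K →ₗ[R] G} {g : G →ₗ[R] M} (h : IsSES f g) (hG : HasGDimensionZero R G)
    {n : ℕ} (hK : HasGResolution R K n) : HasGResolution R M (n + 1) := by
  obtain ⟨G', d, ε, h0, hsub, hε, hd0, hd⟩ := hK
  let d' : ∀ i, (Nat.casesOn (i + 1) (ModuleCat.of R G) G' : ModuleCat.{u} R) →ₗ[R]
      (Nat.casesOn i (ModuleCat.of R G) G' : ModuleCat.{u} R) := fun i ↦
    match i with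
    | 0 => f ∘ₗ ε
    | i + 1 => d i
  refine ⟨fun i ↦ Nat.casesOn i (ModuleCat.of R G) G', d', g, ?_, ?_, h.surjective, ?_, ?_⟩
  · rintro (_ | i)
    · exact hG
    · exact h0 i
  · rintro (_ | i) hi
    · exact absurd hi (Nat.not_lt_zero _)
    · exact hsub i (Nat.lt_of_succ_lt_succ hi)
  · intro x
    change g x = 0 ↔ x ∈ Set.range (f ∘ ε)
    rw [hε.range_comp]
    exact h.exact x
  · rintro (_ | i)
    · intro x
      change f (ε x) = 0 ↔ x ∈ Set.range (d 0)
      rw [← hd0 x, map_eq_zero_iff f h.injective]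
    · exact hd i

lemma HasGResolution.exists_isSES {n : ℕ} (h : HasGResolution R M (n + 1)) :
    ∃ (K G : Type u) (_ : AddCommGroup K) (_ : Module R K) (_ : AddCommGroup G) (_ : Module R G)
      (f : K →ₗ[R] G) (g : G →ₗ[R] M), IsSES f g ∧ HasGDimensionZero R G ∧
        HasGResolution R K n := by
  obtain ⟨G, d, ε, h0, hsub, hε, hd0, hd⟩ := h
  refine ⟨LinearMap.ker ε, G 0, inferInstance, inferInstance, inferInstance, inferInstance,
    (LinearMap.ker ε).subtype, ε, isSES_ker_subtype ε hε, h0 0, fun i ↦ G (i + 1),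
    fun i ↦ d (i + 1), (d 0).codRestrict _ fun x ↦ hd0.apply_apply_eq_zero x, fun i ↦ h0 (i + 1),
    fun i hi ↦ hsub _ (by lia), ?_, ?_, fun i ↦ hd (i + 1)⟩
  · rintro ⟨x, hx⟩
    obtain ⟨y, rfl⟩ := (hd0 x).1 hx
    exact ⟨y, rfl⟩
  · intro x
    rw [← hd 0 x, Subtype.ext_iff]
    rfl

lemma HasGResolution.exists_equiv (h : HasGResolution R M 0) :
    ∃ (G : Type u) (_ : AddCommGroup G) (_ : Module R G), HasGDimensionZero R G ∧
      Nonempty (M ≃ₗ[R] G) := by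
  obtain ⟨G, d, ε, h0, hsub, hε, hd0, -⟩ := h
  have := hsub 1 one_pos
  have hinj : Function.Injective ε := by
    rw [injective_iff_map_eq_zero]
    intro x hx
    obtain ⟨y, rfl⟩ := (hd0 x).1 hx
    rw [Subsingleton.elim y 0, map_zero]
  exact ⟨G 0, inferInstance, inferInstance, h0 0, ⟨(LinearEquiv.ofBijective ε ⟨hinj, hε⟩).symm⟩⟩

lemma gDimension_lt_top_iff : gDimension R M < ⊤ ↔ ∃ n, HasGResolution R M n := by
  simp [gDimension, iInf_lt_iff]

variable [IsNoetherianRing R]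

/-- A module of finite G-dimension embeds in a module of finite projective dimension with cokernel
of G-dimension zero. -/
lemma HasGResolution.exists_hull {n : ℕ} (h : HasGResolution R M n) :
    ∃ (H C : Type u) (_ : AddCommGroup H) (_ : Module R H) (_ : AddCommGroup C) (_ : Module R C)
      (f : M →ₗ[R] H) (g : H →ₗ[R] C), IsSES f g ∧ PdLE R H n ∧ HasGDimensionZero R C := by
  induction n generalizing M with
  | zero =>
    obtain ⟨G, _, _, hG, ⟨e⟩⟩ := h.exists_equiv
    obtain ⟨P, C, _, _, _, _, f, g, _, _, hC, hfg⟩ := hG.exists_cosyzygy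
    refine ⟨P, C, inferInstance, inferInstance, inferInstance, inferInstance, f ∘ₗ e.toLinearMap, g,
      ⟨hfg.injective.comp e.injective, fun x ↦ ?_, hfg.surjective⟩, pdLE_zero_iff.2 inferInstance,
      hC⟩
    rw [hfg.exact x]
    exact (e.surjective.range_comp f ▸ Iff.rfl)
  | succ n ih =>
    obtain ⟨K, G, _, _, _, _, i, e, h₁, hG, hK⟩ := h.exists_isSES
    obtain ⟨H, C, _, _, _, _, f, g, h₂, hH, hC⟩ := ih hK
    -- The pushout P is an extension of C by G, hence of G-dimension zero, and P/H = M. Embedding P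
    -- in a projective F with cokernel of G-dimension zero puts M inside F/H, whose projective
    -- dimension is at most n + 1.
    obtain ⟨P, _, _, u, q, v, p, huq, hvp⟩ := h₁.exists_pushout h₂
    obtain ⟨F, C', _, _, _, _, s, t, _, _, hC', hst⟩ :=
      (huq.hasGDimensionZero_middle hG hC).exists_cosyzygy
    obtain ⟨a, b, hab⟩ := hvp.exists_isSES_quotient hst
    refine ⟨_, C', inferInstance, inferInstance, inferInstance, inferInstance, a, b, hab, ?_, hC'⟩
    exact (isSES_range_mkQ (s ∘ₗ v) (hst.injective.comp hvp.injective)).pdLE_right hH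
      ((pdLE_zero_iff.2 inferInstance).mono (Nat.zero_le _))

/-- A module of finite G-dimension and finite injective dimension has finite projective
dimension. -/
theorem HasGResolution.exists_pdLE {n : ℕ} (h : HasGResolution R M n)
    (hM : HasFiniteInjectiveDimension R M) : PdLE R M n := by
  obtain ⟨H, C, _, _, _, _, f, g, hfg, hH, hC⟩ := h.exists_hull
  obtain ⟨r, hr⟩ := hfg.exists_retraction (hC.extVanishes hM one_pos)
  exact hH.of_retract f r hr

end GResolution

/-! ### Finite G-dimension over a Gorenstein ring -/

section GorensteinGDimension

variable {R : Type u} [CommRing R] [IsNoetherianRing R]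

/-- M* is a syzygy of K*, where K is a syzygy of M satisfying the same hypothesis; iterating raises
the degree beyond the injective dimension of R. -/
lemma extVanishes_dual_of_isGorenstein (hR : HasFiniteInjectiveDimension R R) {M : Type u}
    [AddCommGroup M] [Module R M] [Module.Finite R M] (hM : ∀ i, 0 < i → ExtVanishes R M R i)
    {i : ℕ} (hi : 0 < i) : ExtVanishes R (Module.Dual R M) R i := by
  obtain ⟨n, hn⟩ := hR.exists_extVanishes
  obtain ⟨m, hm⟩ : ∃ m, n < i + m := ⟨n + 1, by lia⟩
  induction m generalizing M i with
  | zero => exact hn _ i hm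
  | succ m ih =>
    obtain ⟨k, g, hg⟩ := exists_finite_free_isSES R M
    exact (hg.dualMap (hM 1 one_pos)).ext_left (extVanishes_of_projective hi)
      (ih (fun j hj ↦ hg.ext_left (extVanishes_of_projective hj) (hM _ j.succ_pos)) i.succ_pos
        (by lia))

/-- The double dual of the free cover is still surjective, and free modules of finite rank are
reflexive. -/
lemma eval_surjective_of_isGorenstein (hR : HasFiniteInjectiveDimension R R) {M : Type u}
    [AddCommGroup M] [Module R M] [Module.Finite R M] (hM : ∀ i, 0 < i → ExtVanishes R M R i) :
    Function.Surjective (Module.Dual.eval R M) := by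
  obtain ⟨k, g, hg⟩ := exists_finite_free_isSES R M
  have hK : ∀ i, 0 < i → ExtVanishes R (LinearMap.ker g) R i := fun j hj ↦
    hg.ext_left (extVanishes_of_projective hj) (hM _ j.succ_pos)
  have hdd := (hg.dualMap (hM 1 one_pos)).dualMap (extVanishes_dual_of_isGorenstein hR hK one_pos)
  intro φ
  obtain ⟨ψ, rfl⟩ := hdd.surjective φ
  obtain ⟨x, rfl⟩ := (Module.bijective_dual_eval R (Fin k → R)).2 ψ
  exact ⟨g x, (eval_eq_dualMap_dualMap g x).symm⟩

lemma hasGDimensionZero_of_isGorenstein (hR : HasFiniteInjectiveDimension R R) {M : Type u}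
    [AddCommGroup M] [Module R M] [Module.Finite R M] (hM : ∀ i, 0 < i → ExtVanishes R M R i) :
    HasGDimensionZero R M := by
  refine ⟨inferInstance, ⟨?_, eval_surjective_of_isGorenstein hR hM⟩, hM,
    fun _ hi ↦ extVanishes_dual_of_isGorenstein hR hM hi⟩
  obtain ⟨k, g, hg⟩ := exists_finite_free_isSES R M
  have hK : ∀ i, 0 < i → ExtVanishes R (LinearMap.ker g) R i := fun j hj ↦
    hg.ext_left (extVanishes_of_projective hj) (hM _ j.succ_pos)
  rw [injective_iff_map_eq_zero]
  intro m hm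
  obtain ⟨x, rfl⟩ := hg.surjective m
  rw [← eval_eq_dualMap_dualMap] at hm
  -- Evaluation at x comes from K**, hence from some y in K by surjectivity for K; reflexivity of
  -- the free module gives x = y, so g x = 0.
  obtain ⟨κ, hκ⟩ := ((hg.dualMap (hM 1 one_pos)).exact_dualMap _).1 hm
  obtain ⟨y, rfl⟩ := eval_surjective_of_isGorenstein hR hK κ
  rw [eval_eq_dualMap_dualMap] at hκ
  rw [← (Module.bijective_dual_eval R (Fin k → R)).1 hκ, hg.exact.apply_apply_eq_zero]

/-- Over a Noetherian ring of finite injective dimension, every finitely generated module has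
finite G-dimension. -/
theorem exists_hasGResolution_of_isGorenstein (hR : HasFiniteInjectiveDimension R R) (M : Type u)
    [AddCommGroup M] [Module R M] [Module.Finite R M] : ∃ n, HasGResolution R M n := by
  obtain ⟨n, hn⟩ := hR.exists_extVanishes
  -- Only the vanishing of Ext^i(M, R) for i > n is kept: it passes to the syzygy with n lowered by
  -- one.
  have h := hn M
  clear hn
  refine ⟨n, ?_⟩
  induction n generalizing M with
  | zero => exact (hasGDimensionZero_of_isGorenstein hR h).hasGResolution
  | succ n ih =>
    obtain ⟨k, g, hg⟩ := exists_finite_free_isSES R M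
    refine HasGResolution.succ hg hasGDimensionZero_of_projective (ih _ fun i hi ↦ ?_)
    exact hg.ext_left (extVanishes_of_projective (Nat.zero_lt_of_lt hi)) (h _ (by lia))

end GorensteinGDimension

end CanonicalGrowth

/-! ### The equivalences, through projectivity of ω -/

theorem mainTheorem9 {R : Type u} [CommRing R] [IsNoetherianRing R] [IsLocalRing R]
    (hR : CanonicalGrowth.IsCohenMacaulayLocalRing R)
    (ω : Type u) [AddCommGroup ω] [Module R ω] (hω : CanonicalGrowth.IsCanonicalModule R ω) :
    (CanonicalGrowth.HasFiniteCIDimension R ω ↔ CanonicalGrowth.gDimension R ω < ⊤) ∧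
      (CanonicalGrowth.gDimension R ω < ⊤ ↔ CanonicalGrowth.IsGorensteinLocalRing R) := by
  have hmcm := hω.isMaximalCohenMacaulay
  have hid := hω.finite_injectiveDimension
  have := hmcm.finite
  have := hmcm.nontrivial
  have h12 : CanonicalGrowth.HasFiniteCIDimension R ω → Module.Projective R ω := fun h ↦ by
    obtain ⟨N, hN⟩ := hid.exists_extVanishes
    obtain ⟨n, hn⟩ := h.exists_pdLE (hN ω)
    exact hmcm.projective_of_pdLE hR hn
  have h21 : Module.Projective R ω → CanonicalGrowth.HasFiniteCIDimension R ω := fun _ ↦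
    CanonicalGrowth.hasFiniteCIDimension_of_projective
  have h32 : CanonicalGrowth.gDimension R ω < ⊤ → Module.Projective R ω := fun h ↦ by
    obtain ⟨n, hn⟩ := CanonicalGrowth.gDimension_lt_top_iff.1 h
    exact hmcm.projective_of_pdLE hR (hn.exists_pdLE hid)
  have h23 : Module.Projective R ω → CanonicalGrowth.gDimension R ω < ⊤ := fun _ ↦
    CanonicalGrowth.gDimension_lt_top_iff.2
      ⟨0, CanonicalGrowth.hasGDimensionZero_of_projective.hasGResolution⟩
  refine ⟨⟨fun h ↦ h23 (h12 h), fun h ↦ h21 (h32 h)⟩, fun h ↦ ?_, fun h ↦ ?_⟩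
  · have := h32 h
    exact CanonicalGrowth.isGorensteinLocalRing_of_projective hid
  · exact CanonicalGrowth.gDimension_lt_top_iff.2
      (CanonicalGrowth.exists_hasGResolution_of_isGorenstein h ω)
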